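/- Let $V$ be a finite-dimensional vector space over a finite field $\mathbb F_q$ that carries an alternating form, a hermitian form, or a quadratic form. Let $\mathbf P$ be the associated classical polar space. Its point set $P$ consists of the totally isotropic (alternating and hermitian case), respectively totally singular (quadratic case), $1$-dimensional subspaces of $V$. Two points are called collinear when they are orthogonal, and $x^\perp$ denotes the set of points collinear with $x$, including $x$ itself. Assume that $\mathbf P$ is nondegenerate, i.e., no point is collinear to all points. Let $U$ be a maximal totally isotropic (respectively totally singular) subspace of $V$, let $d=\dim U$ be the rank of $\mathbf P$, and assume $d\ge 3$. Identify $U$ with its set of points, and let $\mathcal H$ be the set of hyperplanes of $U$. If $y\in P\setminus U$, then $y^\perp\cap U\in\mathcal H$. For a permutation $\phi$ of $\mathcal H$, let $\Gamma_\phi$ be the graph with vertex set $P$ in which 1. distinct points of $U$ are adjacent; 2. distinct points $x,y\notin U$ are adjacent if and only if $x\in y^\perp$; 3. points $x\in U$ and $y\notin U$ are adjacent if and only if $x\in\phi(y^\perp\cap U)$. Let $\mathrm{P\Gamma L}(U)$ act on $\mathcal H$, and regard it as a subgroup of $\mathrm{Sym}(\mathcal H)$: it consists of the permutations of $\mathcal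 H$ induced by the bijective semilinear maps $U\to U$. **Proposition.** Let $\phi$ and $\chi$ be permutations of $\mathcal H$ such that the graphs $\Gamma_\phi$ and $\Gamma_\chi$ are isomorphic. Then $\phi$ and $\chi$ lie in the same $\mathrm{P\Gamma L}(U)$-double coset in $\mathrm{Sym}(\mathcal H)$, that is, $$\mathrm{P\Gamma L}(U)\,\phi\,\mathrm{P\Gamma L}(U)=\mathrm{P\Gamma L}(U)\,\chi\,\mathrm{P\Gamma L}(U).$$ -/

import Mathlib

/-- A form on the vector space `V` over `K` of one of the three kinds that define the classical
polar spaces: symplectic (alternating), hermitian with respect to a field automorphism of order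
two, or quadratic. Nondegeneracy is required of the polar space; see `PolarForm.Nondegenerate`. -/
inductive PolarForm (K V : Type*) [Field K] [AddCommGroup V] [Module K V]
  | symplectic (B : LinearMap.BilinForm K V) (alt : B.IsAlt)
  | hermitian (σ : K ≃+* K) (order_two : ∀ a, σ (σ a) = a) (ne_refl : σ ≠ RingEquiv.refl K)
      (B : V →ₗ[K] V →ₛₗ[(σ : K →+* K)] K) (herm : ∀ v w, σ (B v w) = B w v)
  | quadratic (Q : QuadraticForm K V)

namespace PolarForm

variable {K V : Type*} [Field K] [AddCommGroup V] [Module K V]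

/-- Orthogonality of vectors; for a quadratic form, with respect to its polar form
`Q (v + w) - Q v - Q w`. -/
def Orth : PolarForm K V → V → V → Prop
  | symplectic B _, v, w => B v w = 0
  | hermitian _ _ _ B _, v, w => B v w = 0
  | quadratic Q, v, w => QuadraticMap.polar Q v w = 0

/-- The isotropic (symplectic and hermitian case) or singular (quadratic case) vectors. -/
def IsSingularVec : PolarForm K V → V → Prop
  | symplectic B _, v => B v v = 0
  | hermitian _ _ _ B _, v => B v v = 0
  | quadratic Q, v => Q v = 0

/-- Totally isotropic, respectively totally singular, subspaces: the singular subspaces of the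
polar space. -/
def IsTotallySingular (F : PolarForm K V) (W : Submodule K V) : Prop :=
  (∀ v ∈ W, F.IsSingularVec v) ∧ ∀ v ∈ W, ∀ w ∈ W, F.Orth v w

/-- The points of the polar space: totally singular one-dimensional subspaces. -/
def Point (F : PolarForm K V) : Type _ :=
  {p : Projectivization K V // F.IsTotallySingular p.submodule}

variable {F : PolarForm K V}

/-- The point `x`, as a one-dimensional subspace of `V`. -/
def Point.space (x : F.Point) : Submodule K V := x.1.submodule

/-- Two (possibly equal) points are collinear when they are orthogonal, that is,
when they lie in a common totally singular subspace. -/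
def Point.Collinear (x y : F.Point) : Prop :=
  ∀ v ∈ x.space, ∀ w ∈ y.space, F.Orth v w

/-- The polar space is nondegenerate: no point is collinear to all points. -/
def Nondegenerate (F : PolarForm K V) : Prop :=
  ∀ x : F.Point, ∃ y : F.Point, ¬ x.Collinear y

theorem Orth.symm {v w : V} (h : F.Orth v w) : F.Orth w v := by
  cases F with
  | symplectic B alt => exact alt.isRefl v w h
  | hermitian σ _ _ B herm =>
    change B w v = 0
    rw [← herm v w, show B v w = 0 from h, map_zero]
  | quadratic Q => exact (QuadraticMap.polar_comm Q w v).trans h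

theorem orth_zero_left (F : PolarForm K V) (w : V) : F.Orth 0 w := by
  cases F <;> simp [Orth, QuadraticMap.polar]

theorem Orth.add_left {v v' w : V} (h : F.Orth v w) (h' : F.Orth v' w) : F.Orth (v + v') w := by
  cases F with
  | symplectic B _ => simp_all [Orth]
  | hermitian _ _ _ B _ => simp_all [Orth]
  | quadratic Q => simp_all [Orth, QuadraticMap.polar_add_left]

theorem Orth.smul_left {v w : V} (c : K) (h : F.Orth v w) : F.Orth (c • v) w := by
  cases F with
  | symplectic B _ => simp_all [Orth]
  | hermitian _ _ _ B _ => simp_all [Orth]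
  | quadratic Q => simp_all [Orth, QuadraticMap.polar_smul_left]

theorem Point.Collinear.symm {x y : F.Point} (h : x.Collinear y) : y.Collinear x :=
  fun v hv w hw => (h w hw v hv).symm

/-- The subspace `y^⊥ ∩ U` of `U`. -/
def Point.perpIn (y : F.Point) (U : Submodule K V) : Submodule K V where
  carrier := {u | u ∈ U ∧ ∀ w ∈ y.space, F.Orth u w}
  add_mem' ha hb := ⟨U.add_mem ha.1 hb.1, fun w hw => (ha.2 w hw).add_left (hb.2 w hw)⟩
  zero_mem' := ⟨U.zero_mem, fun w _ => F.orth_zero_left w⟩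
  smul_mem' c _ ha := ⟨U.smul_mem c ha.1, fun w hw => (ha.2 w hw).smul_left c⟩

/-- If `U` is a maximal totally singular subspace and the point `y` is not in `U`,
then `y^⊥ ∩ U` is a hyperplane of `U`. -/
theorem Point.perpIn_covBy {y : F.Point} {U : Submodule K V}
    (hU : Maximal F.IsTotallySingular U) (hy : ¬ y.space ≤ U) : y.perpIn U ⋖ U := by
  obtain ⟨w, hw0, hw⟩ : ∃ w : V, w ≠ 0 ∧ y.space = K ∙ w :=
    ⟨y.1.rep, y.1.rep_nonzero, y.1.submodule_eq⟩
  have hwy : w ∈ y.space := hw ▸ Submodule.mem_span_singleton_self w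
  obtain ⟨l, hl⟩ : ∃ l : V →ₗ[K] K, ∀ v, l v = 0 ↔ F.Orth v w := by
    cases F with
    | symplectic B _ => exact ⟨B.flip w, fun v => Iff.rfl⟩
    | hermitian _ _ _ B _ => exact ⟨B.flip w, fun v => Iff.rfl⟩
    | quadratic Q => exact ⟨(QuadraticMap.polarBilin Q).flip w, fun v => Iff.rfl⟩
  have hperp : y.perpIn U = LinearMap.ker l ⊓ U := by
    ext u
    refine ⟨fun h => ⟨(hl u).2 (h.2 w hwy), h.1⟩, fun h => ⟨h.2, fun w' hw' => ?_⟩⟩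
    rw [hw, Submodule.mem_span_singleton] at hw'
    obtain ⟨c, rfl⟩ := hw'
    exact (((hl u).1 h.1).symm.smul_left c).symm
  have hnot : ¬ U ≤ LinearMap.ker l := by
    intro hle
    have horth : ∀ u ∈ U, ∀ w' ∈ y.space, F.Orth u w' := fun u hu =>
      (show u ∈ y.perpIn U by rw [hperp]; exact ⟨hle hu, hu⟩).2
    have hadd : ∀ a b, F.IsSingularVec a → F.IsSingularVec b → F.Orth a b →
        F.IsSingularVec (a + b) := by
      intro a b ha hb hab
      have hba := hab.symm
      cases F with
      | symplectic B _ => simp_all [Orth, IsSingularVec]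
      | hermitian _ _ _ B _ => simp_all [Orth, IsSingularVec]
      | quadratic Q =>
        simp only [Orth, IsSingularVec, QuadraticMap.polar] at *
        rw [ha, hb, sub_zero, sub_zero] at hab
        exact hab
    refine hy (le_sup_right.trans (hU.2 (y := U ⊔ y.space) ⟨?_, ?_⟩ le_sup_left))
    · intro v hv
      obtain ⟨u, hu, z, hz, rfl⟩ := Submodule.mem_sup.1 hv
      exact hadd u z (hU.1.1 u hu) (y.2.1 z hz) (horth u hu z hz)
    · intro v hv v' hv'
      obtain ⟨u, hu, z, hz, rfl⟩ := Submodule.mem_sup.1 hv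
      obtain ⟨u', hu', z', hz', rfl⟩ := Submodule.mem_sup.1 hv'
      exact ((hU.1.2 u hu u' hu').symm.add_left (horth u hu z' hz').symm).symm.add_left
        ((horth u' hu' z hz).add_left (y.2.2 z' hz' z hz)).symm
  have hco : IsCoatom (LinearMap.ker l) := by
    refine LinearMap.isCoatom_ker_of_surjective (LinearMap.surjective ?_)
    rintro rfl
    exact hnot (by simp)
  rw [hperp]
  exact inf_covBy_of_covBy_sup_left (by
    rw [(hco.2 _ (left_lt_sup.2 hnot) : LinearMap.ker l ⊔ U = ⊤)]
    exact covBy_top_iff.2 hco)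

end PolarForm

/-- The hyperplanes of the vector space `U`: the maximal proper subspaces of `U`. -/
def Hyperplane {K V : Type*} [Field K] [AddCommGroup V] [Module K V] (U : Submodule K V) :
    Type _ :=
  {H : Submodule K V // H ⋖ U}

namespace PolarForm

variable {K V : Type*} [Field K] [AddCommGroup V] [Module K V]

/-- Adjacency in `Γ_φ` of a point `x` in `U` and a point `y` not in `U`:
the point `x` lies on the image under `φ` of the hyperplane `y^⊥ ∩ U` of `U`. -/
def SwitchedIncident (F : PolarForm K V) (U : Submodule K V) (φ : Equiv.Perm (Hyperplane U))
    (x y : F.Point) : Prop :=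
  ∃ H : Hyperplane U, H.1 = y.perpIn U ∧ x.space ≤ (φ H).1

/-- The graph `Γ_φ` on the points of the polar space. -/
def switchedGraph (F : PolarForm K V) (U : Submodule K V) (φ : Equiv.Perm (Hyperplane U)) :
    SimpleGraph F.Point where
  Adj x y := x ≠ y ∧
    ((x.space ≤ U ∧ y.space ≤ U) ∨
      (¬ x.space ≤ U ∧ ¬ y.space ≤ U ∧ x.Collinear y) ∨
      (x.space ≤ U ∧ ¬ y.space ≤ U ∧ F.SwitchedIncident U φ x y) ∨
      (¬ x.space ≤ U ∧ y.space ≤ U ∧ F.SwitchedIncident U φ y x))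
  symm := ⟨fun x y h => ⟨h.1.symm, by
    rcases h.2 with h | h | h | h
    · exact Or.inl ⟨h.2, h.1⟩
    · exact Or.inr (Or.inl ⟨h.2.1, h.1, h.2.2.symm⟩)
    · exact Or.inr (Or.inr (Or.inr ⟨h.2.1, h.1, h.2.2⟩))
    · exact Or.inr (Or.inr (Or.inl ⟨h.2.1, h.1, h.2.2⟩))⟩⟩
  loopless := ⟨fun _ h => h.1 rfl⟩

end PolarForm

/-- `PΓL(U)` as a subgroup of `Sym(𝓗)`: the permutations of the hyperplanes of `U` that are
induced by the bijective semilinear maps from `U` to itself. -/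
def PGammaL {K V : Type*} [Field K] [AddCommGroup V] [Module K V] (U : Submodule K V) :
    Subgroup (Equiv.Perm (Hyperplane U)) where
  carrier := {π | ∃ (σ : K ≃+* K) (f : U →ₛₗ[(σ : K →+* K)] U), Function.Bijective f ∧
    ∀ (H : Hyperplane U) (u : U), (f u : V) ∈ (π H).1 ↔ (u : V) ∈ H.1}
  one_mem' := ⟨RingEquiv.refl K, LinearMap.id, Function.bijective_id, fun _ _ => Iff.rfl⟩
  mul_mem' := by
    rintro π ρ ⟨σ, f, hf, hπ⟩ ⟨τ, g, hg, hρ⟩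
    refine ⟨τ.trans σ, ⟨⟨fun u => f (g u), fun u v => by simp⟩, fun c u => by simp⟩,
      hf.comp hg, fun H u => ?_⟩
    exact (hπ (ρ H) (g u)).trans (hρ H u)
  inv_mem' := by
    rintro π ⟨σ, f, hf, hπ⟩
    let e := Equiv.ofBijective f hf
    have he : ∀ u, f (e.symm u) = u := e.apply_symm_apply
    refine ⟨σ.symm, ⟨⟨e.symm, fun u v => ?_⟩, fun c u => ?_⟩, e.symm.bijective, fun H u => ?_⟩
    · exact hf.1 (by simp [he])
    · exact hf.1 (by simp [he])
    · have := hπ (π⁻¹ H) (e.symm u)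
      rw [he, show π (π⁻¹ H) = H from π.apply_symm_apply H] at this
      exact this.symm

/-!
Call two points *near* each other in `Γ_φ` if they are equal or adjacent; an isomorphism
`g : Γ_φ ≅ Γ_χ` is a bijection of the points preserving nearness. There are two cases.

Suppose `g` maps `U` to itself. The points of `U` near a point `y` outside `U` form the hyperplane
`φ (y^⊥ ∩ U)`, so `g` induces a permutation `α` of the hyperplanes of `U` coming from a permutation
of its points, and `β = χ⁻¹ α φ` maps `y^⊥ ∩ U` to `(g y)^⊥ ∩ U`. Outside `U` nearness is
collinearity, so `g` maps the points of a line disjoint from `U` to points `y₁, y₂, y₃, …` such that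
everything outside `U` collinear with `y₁` and `y₂` is collinear with `y₃`; this applies to `y₁` and
to `y₁ + u` for `u` in `y₁^⊥ ∩ y₂^⊥ ∩ U`, so `β` preserves pencils of hyperplanes (hyperplanes on a
common subspace of codimension two). By the fundamental theorem of projective geometry for the dual
of `U` (`IsCollineation.exists_semilinear`, `Hyperplane.PreservesPencils.mem_PGammaL`), both `α` and
`β` lie in `PΓL(U)`, and `χ = α φ β⁻¹`.

Suppose `g` does not map `U` to itself. Then `χ` is in `PΓL(U)`, and so is `φ` by symmetry, whence
both double cosets are `PΓL(U)`. Indeed, the clique `g(U)` contains a point `m` outside `U`. Let `y`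
be a point of `U` not near `m`. It is the image of a point outside `U`; choose a line through that
point, whose points have distinct perps in `U`, and which `g` maps to `y` and to points outside `U`.
These other image points turn out to have the same perp in `U`, and to lie on a line that meets `U`
in a point `u` (`exists_lineImage_eq` and the first half of `exists_forall_mem_iff`). A point `x`
outside `U` and `g(U)` with `u ∈ x^⊥` is collinear with all or none of them, while it is near one or
all points of the image of the line (`near_lineImage`); in both cases it is near `y`. So `χ` maps the
hyperplanes on `u` to those on `y`. As `y` can be any point of `U` off the hyperplane of points near
`m`, this forces `χ` to preserve pencils (`Hyperplane.preservesPencils_of_points`). A hyperplane `H`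
on `u` escapes this argument only if all points `x` with `x^⊥ ∩ U = H` lie in `g(U)`; in that case
all of `g(U)` outside `U` is orthogonal to `u`, and two points of the line would have the same perp
in `U`. The recurring device for exhibiting points outside the clique `g(U)` is `false_of_preimage`.
-/

/-! ### The fundamental theorem of projective geometry -/

section Fundamental

variable {K E : Type*} [Field K] [AddCommGroup E] [Module K E]

open Submodule

theorem Submodule.eq_zero_of_notMem_span_pair {a b c : E} (ha : a ≠ 0) (hb : b ∉ span K {a})
    (hc : c ∉ span K {a, b}) {α β γ : K} (h : α • a + β • b + γ • c = 0) :
    α = 0 ∧ β = 0 ∧ γ = 0 := by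
  have hγ : γ = 0 := by
    by_contra hγ
    refine hc (mem_span_pair.2 ⟨-γ⁻¹ * α, -γ⁻¹ * β, ?_⟩)
    have : c = -γ⁻¹ • (α • a + β • b) := by
      rw [eq_neg_of_add_eq_zero_left h, smul_neg, neg_smul, neg_neg, inv_smul_smul₀ hγ]
    rw [this, smul_add, smul_smul, smul_smul]
  have hβ : β = 0 := by
    by_contra hβ
    refine hb (mem_span_singleton.2 ⟨-β⁻¹ * α, ?_⟩)
    rw [hγ, zero_smul, add_zero] at h
    rw [mul_smul, eq_neg_of_add_eq_zero_left h, smul_neg, neg_smul, neg_neg, inv_smul_smul₀ hβ]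
  refine ⟨?_, hβ, hγ⟩
  simpa [hβ, hγ, ha] using h

theorem Submodule.mem_span_singleton_comm_of_ne_zero {a y : E} (ha : a ≠ 0) (h : a ∈ span K {y}) :
    y ∈ span K {a} := by
  obtain ⟨c, rfl⟩ := mem_span_singleton.1 h
  have hc : c ≠ 0 := by rintro rfl; simp at ha
  exact mem_span_singleton.2 ⟨c⁻¹, inv_smul_smul₀ hc y⟩

/-- A choice of representatives for a bijection of a projective space that preserves and reflects
collinearity: `t` sends a nonzero vector to a vector spanning the image of the line it spans.
Nothing is required of `t 0`. -/
structure IsCollineation (K : Type*) {E : Type*} [Field K] [AddCommGroup E] [Module K E]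
    (t : E → E) : Prop where
  ne_zero : ∀ {v}, v ≠ 0 → t v ≠ 0
  mem_span_pair : ∀ {u v w}, u ≠ 0 → v ≠ 0 → w ≠ 0 →
    (t w ∈ span K {t u, t v} ↔ w ∈ span K {u, v})

namespace IsCollineation

variable {t : E → E} (ht : IsCollineation K t)
include ht

theorem mem_span_singleton {u v : E} (hu : u ≠ 0) (hv : v ≠ 0) :
    t v ∈ span K {t u} ↔ v ∈ span K {u} := by
  simpa using ht.mem_span_pair hu hu hv

/-- The representative `t a` of the image of `⟨a⟩` can be matched with a representative of the
image of `⟨y⟩`, so that their sum represents the image of `⟨a + y⟩`. -/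
theorem exists_matching {a y : E} (ha : a ≠ 0) (hy : y ∉ span K {a}) :
    ∃ b : K, b ≠ 0 ∧ ∃ α : K, α ≠ 0 ∧ t (a + y) = α • (t a + b • t y) := by
  have hy0 : y ≠ 0 := fun h => hy (h ▸ zero_mem _)
  have hay : a + y ∉ span K {a} := fun h =>
    hy (by simpa using sub_mem h (mem_span_singleton_self a))
  have hay' : a + y ∉ span K {y} := fun h => by
    have h1 : a ∈ span K {y} := by simpa using sub_mem h (mem_span_singleton_self y)
    exact hy (mem_span_singleton_comm_of_ne_zero ha h1)
  have hay0 : a + y ≠ 0 := fun h => hay (h ▸ zero_mem _)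
  obtain ⟨α, β, h⟩ := Submodule.mem_span_pair.1 ((ht.mem_span_pair ha hy0 hay0).2
    (Submodule.mem_span_pair.2 ⟨1, 1, by simp⟩))
  have hα : α ≠ 0 := by
    rintro rfl
    refine hay' ((ht.mem_span_singleton hy0 hay0).1 (Submodule.mem_span_singleton.2 ⟨β, ?_⟩))
    simpa using h
  have hβ : β ≠ 0 := by
    rintro rfl
    refine hay ((ht.mem_span_singleton ha hay0).1 (Submodule.mem_span_singleton.2 ⟨α, ?_⟩))
    simpa using h
  refine ⟨α⁻¹ * β, mul_ne_zero (inv_ne_zero hα) hβ, α, hα, ?_⟩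
  rw [← h, smul_add, mul_smul, smul_inv_smul₀ hα]

/-- Matched representatives are additive. The point `⟨a + y + z⟩` lies on the lines joining
`⟨a + y⟩` to `⟨z⟩`, `⟨a + z⟩` to `⟨y⟩` and `⟨a⟩` to `⟨y + z⟩`; comparing coefficients on the images
of these lines shows that its image is spanned by `t a + f y + f z` and by `t a + f (y + z)`. -/
theorem matching_add {a y z : E} (ha : a ≠ 0) (hy : y ∉ span K {a}) (hz : z ∉ span K {a, y})
    {f : E → E} (hf : ∀ y ∉ span K {a}, (∃ b : K, b ≠ 0 ∧ f y = b • t y) ∧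
      ∃ α : K, α ≠ 0 ∧ t (a + y) = α • (t a + f y)) :
    f (y + z) = f y + f z := by
  have hz1 : z ∉ span K {a} := fun h => hz (span_mono (by simp) h)
  have hy0 : y ≠ 0 := fun h => hy (h ▸ zero_mem _)
  have hz0 : z ≠ 0 := fun h => hz (h ▸ zero_mem _)
  have hw1 : y + z ∉ span K {a} := fun h => hz (by
    simpa using sub_mem (span_mono (by simp) h : y + z ∈ span K {a, y})
      (subset_span (by simp : y ∈ ({a, y} : Set E))))
  have hw0 : y + z ≠ 0 := fun h => hw1 (h ▸ zero_mem _)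
  have hay0 : a + y ≠ 0 := fun h =>
    hy (Submodule.mem_span_singleton.2 ⟨-1, by rw [neg_one_smul, neg_eq_of_add_eq_zero_right h]⟩)
  have haz0 : a + z ≠ 0 := fun h =>
    hz1 (Submodule.mem_span_singleton.2 ⟨-1, by rw [neg_one_smul, neg_eq_of_add_eq_zero_right h]⟩)
  have hs0 : a + (y + z) ≠ 0 := fun h =>
    hw1 (Submodule.mem_span_singleton.2 ⟨-1, by rw [neg_one_smul, neg_eq_of_add_eq_zero_right h]⟩)
  obtain ⟨⟨b, hb, hfy⟩, α, hα, hay⟩ := hf y hy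
  obtain ⟨⟨c, hc, hfz⟩, β, hβ, haz⟩ := hf z hz1
  obtain ⟨⟨d, hd, hfw⟩, γ, hγ, haw⟩ := hf (y + z) hw1
  obtain ⟨x₁, x₂, h₁⟩ := Submodule.mem_span_pair.1 ((ht.mem_span_pair hay0 hz0 hs0).2
    (Submodule.mem_span_pair.2 ⟨1, 1, by module⟩))
  obtain ⟨x₃, x₄, h₂⟩ := Submodule.mem_span_pair.1 ((ht.mem_span_pair haz0 hy0 hs0).2
    (Submodule.mem_span_pair.2 ⟨1, 1, by module⟩))
  obtain ⟨r, s, h₃⟩ := Submodule.mem_span_pair.1 ((ht.mem_span_pair hy0 hz0 hw0).2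
    (Submodule.mem_span_pair.2 ⟨1, 1, by module⟩))
  have key {p q r : K} := eq_zero_of_notMem_span_pair (K := K) (α := p) (β := q) (γ := r)
    (ht.ne_zero ha) (fun h => hy ((ht.mem_span_singleton ha hy0).1 h))
    (fun h => hz ((ht.mem_span_pair ha hy0 hz0).1 h))
  rw [hfw, ← h₃] at haw ⊢
  rw [hfy] at hay ⊢
  rw [hfz] at haz ⊢
  rw [hay, haw] at h₁
  rw [haz, haw] at h₂
  obtain ⟨e₁, e₂, e₃⟩ := key (p := x₁ * α - γ) (q := x₁ * α * b - γ * (d * r))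
    (r := x₂ - γ * (d * s)) (by linear_combination (norm := module) h₁)
  obtain ⟨e₄, e₅, e₆⟩ := key (p := x₃ * β - γ) (q := x₄ - γ * (d * r))
    (r := x₃ * β * c - γ * (d * s)) (by linear_combination (norm := module) h₂)
  have hb' : d * r = b := mul_left_cancel₀ hγ (by linear_combination b * e₁ - e₂)
  have hc' : d * s = c := mul_left_cancel₀ hγ (by linear_combination c * e₄ - e₆)
  rw [← hb', ← hc']
  module

/-- The representatives of a collineation of a projective space of dimension at least two can be
rescaled to form an additive map. Matching with `t a` does so outside `⟨a⟩`, and differences of the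
values there extend the map to `⟨a⟩`. -/
theorem exists_additive (h3 : ∀ a b : E, ∃ c, c ∉ span K {a, b}) :
    ∃ F : E →+ E, ∀ v ≠ 0, ∃ b : K, b ≠ 0 ∧ F v = b • t v := by
  obtain ⟨a, ha⟩ := h3 0 0
  replace ha : a ≠ 0 := by rintro rfl; exact ha (zero_mem _)
  have hf : ∀ y, ∃ w, y ∉ span K {a} → (∃ b : K, b ≠ 0 ∧ w = b • t y) ∧
      ∃ α : K, α ≠ 0 ∧ t (a + y) = α • (t a + w) := by
    intro y
    by_cases hy : y ∈ span K {a}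
    · exact ⟨0, fun h => (h hy).elim⟩
    · obtain ⟨b, hb, h⟩ := ht.exists_matching ha hy
      exact ⟨b • t y, fun _ => ⟨⟨b, hb, rfl⟩, h⟩⟩
  choose f hf using hf
  have hadd : ∀ y z, y ∉ span K {a} → z ∉ span K {a, y} → f (y + z) = f y + f z :=
    fun y z hy hz => ht.matching_add ha hy hz hf
  have mono : ∀ {x y : E}, x ∉ span K {a, y} → x ∉ span K {a} :=
    fun h h' => h (span_mono (by simp) h')
  have shift : ∀ {x y z : E}, x ∉ span K {a, y} → z ∈ span K {a, y} → x + z ∉ span K {a, y} :=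
    fun h hz h' => h ((add_mem_cancel_right hz).1 h')
  -- `f (y + c) - f c` does not depend on the vector `c` outside `⟨a, y⟩`
  have indep : ∀ y c d, c ∉ span K {a, y} → d ∉ span K {a, y} →
      f (y + c) - f c = f (y + d) - f d := by
    intro y c d hc hd
    by_cases hy : y ∈ span K {a}
    · have step : ∀ c d, c ∉ span K {a} → d ∉ span K {a, c} →
          f (y + c) - f c = f (y + d) - f d := by
        intro c d hc hd
        have hy' : ∀ x, y ∈ span K {a, x} := fun x => span_mono (by simp) hy
        have h1 : f (y + c + d) = f (y + c) + f d := by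
          refine hadd _ _ (fun h => hc ((add_mem_cancel_left hy).1 h)) fun h => hd ?_
          refine span_le.2 ?_ h
          rintro x (rfl | rfl)
          · exact subset_span (by simp)
          · exact add_mem (hy' _) (subset_span (by simp))
        have h2 : f (c + (y + d)) = f c + f (y + d) :=
          hadd _ _ hc fun h => hd ((add_mem_cancel_left (hy' c)).1 h)
        rw [show c + (y + d) = y + c + d by abel, h1] at h2
        rw [sub_eq_sub_iff_add_eq_add, h2, add_comm]
      by_cases hcd : d ∈ span K {a, c}
      · obtain ⟨e, he⟩ := h3 a c
        rw [step c e (mono hc) he]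
        refine (step d e (mono hd) fun h => he (span_le.2 ?_ h)).symm
        rintro x (rfl | rfl)
        · exact subset_span (by simp)
        · exact hcd
      · exact step c d (mono hc) hcd
    · rw [hadd y c hy hc, hadd y d hy hd, add_sub_cancel_right, add_sub_cancel_right]
  choose c hc using h3 a
  have hF : ∀ y d, d ∉ span K {a, y} → f (y + c y) - f (c y) = f (y + d) - f d :=
    fun y d hd => indep y _ _ (hc y) hd
  have hFf : ∀ y, y ∉ span K {a} → f (y + c y) - f (c y) = f y := fun y hy => by
    rw [hadd y _ hy (hc y), add_sub_cancel_right]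
  have hFadd : ∀ y z, f (y + z + c (y + z)) - f (c (y + z)) =
      f (y + c y) - f (c y) + (f (z + c z) - f (c z)) := by
    intro y z
    have main : ∀ d, d ∉ span K {a, y} → d ∉ span K {a, y + z} → y + d ∉ span K {a, z} →
        f (y + z + c (y + z)) - f (c (y + z)) =
          f (y + c y) - f (c y) + (f (z + c z) - f (c z)) := by
      intro d h1 h2 h3
      rw [hF (y + z) d h2, hF y d h1, hF z _ h3, show z + (y + d) = y + z + d by abel]
      abel
    by_cases hy : y ∈ span K {a}
    · have hz : ∀ x, y ∈ span K {a, x} := fun x => span_mono (by simp) hy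
      refine main (c z) (fun h => hc z ?_) (fun h => hc z ?_)
        fun h => hc z ((add_mem_cancel_left (hz z)).1 h)
      · refine span_le.2 ?_ h
        rintro x (rfl | rfl)
        · exact subset_span (by simp)
        · exact hz z
      · refine span_le.2 ?_ h
        rintro x (rfl | rfl)
        · exact subset_span (by simp)
        · exact add_mem (hz z) (subset_span (by simp))
    · by_cases hz : z ∈ span K {a, y}
      · have h1 : ∀ x ∈ span K {a, y}, c y ∉ span K {a, x} := fun x hx h => hc y <| by
          refine span_le.2 ?_ h
          rintro w (rfl | rfl)
          · exact subset_span (by simp)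
          · exact hx
        have hyy : y ∈ span K {a, y} := subset_span (by simp)
        refine main (c y) (hc y) (h1 _ (add_mem hyy hz)) fun h => hc y ?_
        refine (add_mem_cancel_left hyy).1 (span_le.2 ?_ h)
        rintro w (rfl | rfl)
        · exact subset_span (by simp)
        · exact hz
      · rw [hFf y hy, hFf z (mono hz), hFf (y + z) fun h => hz ?_, hadd y z hy hz]
        exact (add_mem_cancel_left (subset_span (by simp))).1 (span_mono (by simp) h)
  refine ⟨AddMonoidHom.mk' (fun y => f (y + c y) - f (c y)) hFadd, fun v hv => ?_⟩
  change ∃ b : K, b ≠ 0 ∧ f (v + c v) - f (c v) = b • t v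
  by_cases hva : v ∈ span K {a}
  · obtain ⟨d, hd⟩ := h3 a (c v)
    have hav : a ∈ span K {v} := mem_span_singleton_comm_of_ne_zero hv hva
    have hva' : ∀ x, span K {v, x} ≤ span K {a, x} := fun x => span_le.2 <| by
      rintro w (rfl | rfl)
      · exact span_mono (by simp) hva
      · exact subset_span (by simp)
    have hdv : d ∉ span K {a, v} := fun h => mono hd <| by
      refine span_le.2 ?_ h
      rintro w (rfl | rfl)
      · exact subset_span (by simp)
      · exact hva
    -- the value at `v` lies on the lines through the image of `⟨v⟩` and that of `⟨e⟩`
    have line : ∀ e, e ∉ span K {a, v} → ∃ p q : K,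
        f (v + c v) - f (c v) = p • t v + q • t e := by
      intro e he
      have he0 : e ≠ 0 := fun h => he (h ▸ zero_mem _)
      have hve : v + e ∉ span K {a} := fun h => mono he ((add_mem_cancel_left hva).1 h)
      obtain ⟨⟨b, -, h1⟩, -⟩ := hf e (mono he)
      obtain ⟨⟨b', -, h2⟩, -⟩ := hf (v + e) hve
      obtain ⟨r, s, h⟩ := Submodule.mem_span_pair.1 ((ht.mem_span_pair hv he0
        (fun h => hve (h ▸ zero_mem _) : v + e ≠ 0)).2
        (Submodule.mem_span_pair.2 ⟨1, 1, by module⟩))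
      refine ⟨b' * r, b' * s - b, ?_⟩
      rw [hF v e he, h1, h2, ← h]
      module
    obtain ⟨p, q, h1⟩ := line (c v) (hc v)
    obtain ⟨p', q', h2⟩ := line d hdv
    have hc0 : c v ≠ 0 := fun h => hc v (h ▸ zero_mem _)
    have hd0 : d ≠ 0 := fun h => hd (h ▸ zero_mem _)
    have hcv : c v ∉ span K {v} := fun h => hc v (span_mono (by simp) h)
    obtain ⟨-, hq, -⟩ := eq_zero_of_notMem_span_pair (K := K) (α := p - p') (β := q) (γ := -q')
      (ht.ne_zero hv) (fun h => hcv ((ht.mem_span_singleton hv hc0).1 h))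
      (fun h => hd (hva' _ ((ht.mem_span_pair hv hc0 hd0).1 h)))
      (by linear_combination (norm := module) h2 - h1)
    rw [hq, zero_smul, add_zero] at h1
    refine ⟨p, ?_, h1⟩
    -- the value is nonzero because `v + c v` and `c v` span different lines
    rintro rfl
    rw [zero_smul, sub_eq_zero] at h1
    have hvc : v + c v ∉ span K {a} := fun h => mono (hc v) ((add_mem_cancel_left hva).1 h)
    obtain ⟨⟨b, hb, e1⟩, -⟩ := hf (c v) (mono (hc v))
    obtain ⟨⟨b', hb', e2⟩, -⟩ := hf (v + c v) hvc
    rw [e1, e2] at h1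
    have h4 : v + c v ∈ span K {c v} := by
      refine (ht.mem_span_singleton hc0 (by rintro h; exact hvc (h ▸ zero_mem _) : v + c v ≠ 0)).1
        (Submodule.mem_span_singleton.2 ⟨b'⁻¹ * b, ?_⟩)
      rw [mul_smul, ← h1, inv_smul_smul₀ hb']
    exact hcv (mem_span_singleton_comm_of_ne_zero hv
      ((add_mem_cancel_right (mem_span_singleton_self _)).1 h4))
  · rw [hFf v hva]
    exact (hf v hva).1

/-- The fundamental theorem of projective geometry over a finite field. Finiteness serves only to
make the companion field endomorphism surjective. -/
theorem exists_semilinear [Finite K] [FiniteDimensional K E]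
    (h3 : ∀ a b : E, ∃ c, c ∉ span K {a, b}) :
    ∃ (σ : K ≃+* K) (F : E →ₛₗ[(σ : K →+* K)] E), Function.Bijective F ∧
      ∀ v ≠ 0, ∃ b : K, b ≠ 0 ∧ F v = b • t v := by
  obtain ⟨F, hF⟩ := ht.exists_additive h3
  have hF0 : ∀ v ≠ 0, F v ≠ 0 := fun v hv => by
    obtain ⟨b, hb, h⟩ := hF v hv
    rw [h]
    exact smul_ne_zero hb (ht.ne_zero hv)
  have hFinj : Function.Injective F := (injective_iff_map_eq_zero F).2 fun v hv => by
    by_contra h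
    exact hF0 v h hv
  -- `F (c • v)` is a multiple of `F v`
  have hsmul : ∀ (c : K) (v : E), ∃ d : K, F (c • v) = d • F v := by
    intro c v
    by_cases hcv : c • v = 0
    · exact ⟨0, by simp [hcv]⟩
    have hv : v ≠ 0 := fun h => hcv (by simp [h])
    obtain ⟨b, hb, h⟩ := hF v hv
    obtain ⟨b', hb', h'⟩ := hF _ hcv
    obtain ⟨e, he⟩ := Submodule.mem_span_singleton.1 ((ht.mem_span_singleton hv hcv).2
      (Submodule.mem_span_singleton.2 ⟨c, rfl⟩))
    refine ⟨b' * e * b⁻¹, ?_⟩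
    rw [h, h', ← he, mul_smul, mul_smul, inv_smul_smul₀ hb]
  obtain ⟨a, ha⟩ := h3 0 0
  replace ha : a ≠ 0 := by rintro rfl; exact ha (zero_mem _)
  choose s hs using fun c => hsmul c a
  -- the factor does not depend on the vector
  have hind : ∀ (c : K) (w : E), w ∉ span K {a} → F (c • w) = s c • F w := by
    intro c w hw
    have hw0 : w ≠ 0 := fun h => hw (h ▸ zero_mem _)
    obtain ⟨d, hd⟩ := hsmul c w
    obtain ⟨e, he⟩ := hsmul c (a + w)
    rw [smul_add, map_add, map_add, hs, hd] at he
    have hlin : ∀ p q : K, p • F a + q • F w = 0 → p = 0 ∧ q = 0 := by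
      intro p q h
      obtain ⟨b, hb, h1⟩ := hF a ha
      obtain ⟨b', hb', h2⟩ := hF w hw0
      have hq : q = 0 := by
        by_contra hq
        refine hw ((ht.mem_span_singleton ha hw0).1
          (Submodule.mem_span_singleton.2 ⟨-(q * b')⁻¹ * (p * b), ?_⟩))
        rw [h1, h2, smul_smul, smul_smul] at h
        rw [mul_smul, eq_neg_of_add_eq_zero_left h, smul_neg, neg_smul, neg_neg,
          inv_smul_smul₀ (mul_ne_zero hq hb')]
      exact ⟨by simpa [hq, hF0 a ha] using h, hq⟩
    obtain ⟨h1, h2⟩ := hlin (s c - e) (d - e) (by linear_combination (norm := module) he)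
    rw [hd, show d = s c by linear_combination h2 - h1]
  have hall : ∀ (c : K) (w : E), F (c • w) = s c • F w := by
    intro c w
    by_cases hw : w ∈ span K {a}
    · obtain ⟨x, hx⟩ := h3 a a
      have hx' : x ∉ span K {a} := by simpa using hx
      have h1 := hind c (w + x) fun h => hx' ((add_mem_cancel_left hw).1 h)
      rw [smul_add, map_add, map_add, hind c x hx', smul_add] at h1
      exact add_right_cancel h1
    · exact hind c w hw
  have hcancel : ∀ {p q : K}, p • F a = q • F a → p = q :=
    fun h => smul_left_injective K (hF0 a ha) h
  let σ : K →+* K :=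
    { toFun := s
      map_one' := hcancel (by rw [← hs, one_smul, one_smul])
      map_zero' := hcancel (by rw [← hs, zero_smul, zero_smul, map_zero])
      map_mul' := fun x y => hcancel (by rw [← hs, mul_smul, hall, hs, mul_smul])
      map_add' := fun x y => hcancel (by rw [← hs, add_smul, map_add, hs, hs, add_smul]) }
  have hσ : Function.Bijective σ := Finite.injective_iff_bijective.1 σ.injective
  have : Finite E := Module.finite_of_finite K
  exact ⟨RingEquiv.ofBijective σ hσ, ⟨⟨F, map_add F⟩, hall⟩,
    Finite.injective_iff_bijective.1 hFinj, hF⟩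

end IsCollineation
end Fundamental

theorem Submodule.le_or_le_of_forall {K V : Type*} [Field K] [AddCommGroup V] [Module K V]
    {X A B : Submodule K V} (h : ∀ x ∈ X, x ∉ A → x ∈ B) : X ≤ A ∨ X ≤ B :=
  AddSubgroupClass.subset_union.1 fun x hx => or_iff_not_imp_left.2 (h x hx)

theorem Equiv.iff_of_forall_imp {α : Type*} [Finite α] (e : α ≃ α) {p : α → Prop}
    (h : ∀ x, p x → p (e x)) (x : α) : p (e x) ↔ p x := by
  refine ⟨fun hx => ?_, h x⟩
  simpa using Equiv.Perm.perm_symm_on_of_perm_on_finite (f := e) (p := p) (fun {x} => h x) hx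

theorem Submodule.ne_zero_of_notMem {K V : Type*} [Field K] [AddCommGroup V] [Module K V]
    {U : Submodule K V} {v : V} (h : v ∉ U) : v ≠ 0 := by
  rintro rfl
  exact h U.zero_mem

/-! ### Hyperplanes -/

namespace Hyperplane

variable {K V : Type*} [Field K] [AddCommGroup V] [Module K V] {U : Submodule K V}

theorem le (H : Hyperplane U) : H.1 ≤ U := H.2.le

theorem eq_of_le {H₁ H₂ : Hyperplane U} (h : H₁.1 ≤ H₂.1) : H₁ = H₂ :=
  Subtype.ext (h.eq_of_not_lt fun hlt => H₁.2.2 hlt H₂.2.lt)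

theorem eq_of_forall_mem {H₁ H₂ : Hyperplane U} (h : ∀ u : U, (u : V) ∈ H₁.1 → (u : V) ∈ H₂.1) :
    H₁ = H₂ :=
  eq_of_le fun u hu => h ⟨u, H₁.le hu⟩ hu

theorem exists_notMem (H : Hyperplane U) : ∃ u ∈ U, u ∉ H.1 :=
  SetLike.not_le_iff_exists.1 H.2.lt.not_ge

theorem exists_dual (H : Hyperplane U) :
    ∃ l : Module.Dual K U, l ≠ 0 ∧ ∀ u : U, (u : V) ∈ H.1 ↔ l u = 0 := by
  have hlt : H.1.comap U.subtype < ⊤ := by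
    obtain ⟨u, hu, hu'⟩ := H.exists_notMem
    exact lt_top_iff_ne_top.2 fun h =>
      hu' ((h ▸ Submodule.mem_top : (⟨u, hu⟩ : U) ∈ H.1.comap U.subtype))
  obtain ⟨l, hl, hle⟩ := Submodule.exists_le_ker_of_lt_top _ hlt
  refine ⟨l, hl, fun u => ⟨fun hu => hle hu, fun hu => ?_⟩⟩
  have h1 : H.1 ≤ (LinearMap.ker l).map U.subtype := fun v hv =>
    ⟨⟨v, H.le hv⟩, hle (show _ ∈ H.1 from hv), rfl⟩
  have h2 : ¬ H.1 < (LinearMap.ker l).map U.subtype := fun h => by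
    refine H.2.2 h (lt_of_le_of_ne (Submodule.map_subtype_le _ _) fun heq => hl ?_)
    ext w
    obtain ⟨w', hw', e⟩ := heq.ge w.2
    exact (show w' = w from Subtype.ext e) ▸ hw'
  rw [h1.eq_of_not_lt h2]
  exact ⟨u, hu, rfl⟩

theorem exists_of_dual {l : Module.Dual K U} (hl : l ≠ 0) :
    ∃ H : Hyperplane U, ∀ u : U, (u : V) ∈ H.1 ↔ l u = 0 := by
  have hco := LinearMap.isCoatom_ker_of_surjective (LinearMap.surjective hl)
  refine ⟨⟨(LinearMap.ker l).map U.subtype, ?_⟩, fun u => ?_⟩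
  · have h1 : (LinearMap.ker l).map U.subtype =
        ((Submodule.mapIic U (LinearMap.ker l) : Set.Iic U) : Submodule K V) := rfl
    rw [h1, ← Set.Iic.isCoatom_iff]
    exact (OrderIso.isCoatom_iff _ _).2 hco
  · simp

theorem exists_mem_notMem {u v : U} (h : v ∉ Submodule.span K {u}) :
    ∃ H : Hyperplane U, (u : V) ∈ H.1 ∧ (v : V) ∉ H.1 := by
  obtain ⟨l, hl, hle⟩ := Submodule.exists_le_ker_of_notMem h
  obtain ⟨H, hH⟩ := exists_of_dual (l := l) (by rintro rfl; exact hl rfl)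
  exact ⟨H, (hH u).2 (hle (Submodule.mem_span_singleton_self u)), fun h => hl ((hH v).1 h)⟩

instance [Finite V] : Finite (Hyperplane U) :=
  Finite.of_injective (fun H => ({v | v ∈ H.1} : Set V)) fun _ _ h =>
    Subtype.ext (SetLike.ext' h)

/-- The linear group of `U` is transitive on the nonzero vectors. -/
theorem exists_perm_mem_iff [Finite V] {u v : U} (hu : u ≠ 0) (hv : v ≠ 0) :
    ∃ π : Equiv.Perm (Hyperplane U), ∀ H, (v : V) ∈ (π H).1 ↔ (u : V) ∈ H.1 := by
  obtain ⟨e, he⟩ : ∃ e : U ≃ₗ[K] U, e u = v := by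
    obtain ⟨g, hg⟩ := Submodule.exists_linearEquiv_restrict_eq
      ((LinearEquiv.toSpanNonzeroSingleton K U u hu).symm ≪≫ₗ
        LinearEquiv.toSpanNonzeroSingleton K U v hv)
    have := hg (LinearEquiv.toSpanNonzeroSingleton K U u hu 1)
    rw [LinearEquiv.trans_apply, LinearEquiv.symm_apply_apply] at this
    exact ⟨g, by simpa using this.symm⟩
  have h (H : Hyperplane U) :
      ∃ H' : Hyperplane U, ∀ w : U, ((e w : U) : V) ∈ H'.1 ↔ (w : V) ∈ H.1 := by
    obtain ⟨l, hl, hH⟩ := H.exists_dual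
    obtain ⟨H', hH'⟩ := exists_of_dual (l := l ∘ₗ e.symm.toLinearMap) fun h0 => hl <| by
      ext w
      simpa using LinearMap.congr_fun h0 (e w)
    exact ⟨H', fun w => by simp [hH, hH']⟩
  choose T hT using h
  have hinj : Function.Injective T := fun H₁ H₂ h => eq_of_forall_mem fun w hw => by
    rwa [← hT, ← h, hT]
  exact ⟨Equiv.ofBijective T (Finite.injective_iff_bijective.1 hinj), fun H => he ▸ hT H u⟩

/-- All points of `U` lie on equally many hyperplanes, so a permutation of the hyperplanes mapping
those on `u` to hyperplanes on `v` reaches all of these. -/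
theorem mem_iff_of_forall_imp [Finite V] {u v : U} (hu : u ≠ 0) (hv : v ≠ 0)
    {χ : Equiv.Perm (Hyperplane U)} (h : ∀ H, (u : V) ∈ H.1 → (v : V) ∈ (χ H).1)
    (H : Hyperplane U) : (v : V) ∈ (χ H).1 ↔ (u : V) ∈ H.1 := by
  obtain ⟨π, hπ⟩ := exists_perm_mem_iff hv hu
  rw [← hπ]
  exact (χ.trans π).iff_of_forall_imp (p := fun H => (u : V) ∈ H.1)
    (fun H hH => (hπ _).2 (h H hH)) H

theorem exists_mem [FiniteDimensional K V] (hd : 3 ≤ Module.finrank K U) (v : U) :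
    ∃ H : Hyperplane U, (v : V) ∈ H.1 := by
  obtain ⟨w, hw⟩ : ∃ w, w ∉ Submodule.span K {v} := by
    by_contra! h
    have h1 := (finrank_span_le_card (R := K) ({v} : Set U))
    rw [(eq_top_iff.2 fun w _ => h w : Submodule.span K {v} = ⊤), finrank_top] at h1
    simp at h1
    omega
  obtain ⟨H, hH, -⟩ := exists_mem_notMem hw
  exact ⟨H, hH⟩

theorem exists_ne_zero_mem_inf [FiniteDimensional K V] (hd : 3 ≤ Module.finrank K U)
    (H₁ H₂ : Hyperplane U) : ∃ u : U, u ≠ 0 ∧ (u : V) ∈ H₁.1 ∧ (u : V) ∈ H₂.1 := by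
  obtain ⟨l₁, -, h₁⟩ := H₁.exists_dual
  obtain ⟨l₂, -, h₂⟩ := H₂.exists_dual
  obtain ⟨u, hu, hu0⟩ := (Submodule.ne_bot_iff _).1
    (LinearMap.ker_ne_bot_of_finrank_lt (f := l₁.prod l₂) (by simp; omega))
  have : l₁ u = 0 ∧ l₂ u = 0 := by simpa using hu
  exact ⟨u, hu0, (h₁ u).2 this.1, (h₂ u).2 this.2⟩

theorem inf_le_iff_mem_span {H₁ H₂ H₃ : Hyperplane U} {l₁ l₂ l₃ : Module.Dual K U}
    (h₁ : ∀ u : U, (u : V) ∈ H₁.1 ↔ l₁ u = 0) (h₂ : ∀ u : U, (u : V) ∈ H₂.1 ↔ l₂ u = 0)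
    (h₃ : ∀ u : U, (u : V) ∈ H₃.1 ↔ l₃ u = 0) :
    H₁.1 ⊓ H₂.1 ≤ H₃.1 ↔ l₃ ∈ Submodule.span K {l₁, l₂} := by
  constructor
  · intro h
    have := mem_span_of_iInf_ker_le_ker (L := ![l₁, l₂]) (K := l₃) fun u hu => by
      have hu : l₁ u = 0 ∧ l₂ u = 0 := by simpa using hu
      exact (h₃ u).1 (h ⟨(h₁ u).2 hu.1, (h₂ u).2 hu.2⟩)
    simpa [Set.pair_comm] using this
  · rintro h v ⟨hv₁, hv₂⟩
    obtain ⟨a, b, rfl⟩ := Submodule.mem_span_pair.1 h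
    exact (h₃ ⟨v, H₁.le hv₁⟩).2 (by simp [(h₁ ⟨v, H₁.le hv₁⟩).1 hv₁, (h₂ ⟨v, H₁.le hv₁⟩).1 hv₂])

/-- Any two distinct members of a pencil of hyperplanes meet in the axis of the pencil. -/
theorem exchange {P Q R : Hyperplane U} (h : P.1 ⊓ Q.1 ≤ R.1) (hne : P ≠ R) :
    P.1 ⊓ R.1 ≤ Q.1 := by
  obtain ⟨p, -, hp⟩ := P.exists_dual
  obtain ⟨q, -, hq⟩ := Q.exists_dual
  obtain ⟨r, -, hr⟩ := R.exists_dual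
  obtain ⟨a, b, rfl⟩ := Submodule.mem_span_pair.1 ((inf_le_iff_mem_span hp hq hr).1 h)
  have hb : b ≠ 0 := by
    rintro rfl
    exact hne (eq_of_forall_mem fun u hu => (hr u).2 (by simp [(hp u).1 hu]))
  rintro v ⟨hvP, hvR⟩
  have h1 := (hp ⟨v, P.le hvP⟩).1 hvP
  have h2 := (hr ⟨v, P.le hvP⟩).1 hvR
  exact (hq ⟨v, P.le hvP⟩).2 (by simpa [h1, hb] using h2)

/-- A permutation of the hyperplanes preserves pencils if it maps hyperplanes on a common subspace
of codimension two to hyperplanes on a common subspace of codimension two. -/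
def PreservesPencils (π : Equiv.Perm (Hyperplane U)) : Prop :=
  ∀ H₁ H₂ H₃ : Hyperplane U, H₁.1 ⊓ H₂.1 ≤ H₃.1 → (π H₁).1 ⊓ (π H₂).1 ≤ (π H₃).1

/-- The fundamental theorem of projective geometry for the dual space of `U`, transposed to `U`. -/
theorem PreservesPencils.mem_PGammaL [Finite K] [FiniteDimensional K V]
    (hd : 3 ≤ Module.finrank K U) {π : Equiv.Perm (Hyperplane U)} (hπ : PreservesPencils π) :
    π ∈ PGammaL U := by
  have : Finite V := Module.finite_of_finite K
  have hπ' (H₁ H₂ H₃ : Hyperplane U) :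
      (π H₁).1 ⊓ (π H₂).1 ≤ (π H₃).1 ↔ H₁.1 ⊓ H₂.1 ≤ H₃.1 :=
    (π.prodCongr (π.prodCongr π)).iff_of_forall_imp
      (p := fun H => H.1.1 ⊓ H.2.1.1 ≤ H.2.2.1) (fun H => hπ H.1 H.2.1 H.2.2) (H₁, H₂, H₃)
  have ht (l : Module.Dual K U) : ∃ l' : Module.Dual K U, l ≠ 0 → l' ≠ 0 ∧
      ∀ H : Hyperplane U, (∀ u : U, (u : V) ∈ H.1 ↔ l u = 0) →
        ∀ u : U, (u : V) ∈ (π H).1 ↔ l' u = 0 := by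
    by_cases hl : l = 0
    · exact ⟨0, fun h => (h hl).elim⟩
    obtain ⟨H, hH⟩ := exists_of_dual hl
    obtain ⟨l', hl', h⟩ := (π H).exists_dual
    refine ⟨l', fun _ => ⟨hl', fun H' hH' => ?_⟩⟩
    rwa [show H' = H from eq_of_forall_mem fun u hu => (hH u).2 ((hH' u).1 hu)]
  choose t ht using ht
  have hcol : IsCollineation K t :=
    ⟨fun hl => (ht _ hl).1, fun {l₁ l₂ l₃} h₁ h₂ h₃ => by
      obtain ⟨H₁, e₁⟩ := exists_of_dual h₁
      obtain ⟨H₂, e₂⟩ := exists_of_dual h₂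
      obtain ⟨H₃, e₃⟩ := exists_of_dual h₃
      rw [← inf_le_iff_mem_span e₁ e₂ e₃, ← hπ', inf_le_iff_mem_span ((ht _ h₁).2 _ e₁)
        ((ht _ h₂).2 _ e₂) ((ht _ h₃).2 _ e₃)]⟩
  obtain ⟨σ, F, hF, hFt⟩ := hcol.exists_semilinear fun a b => by
    classical
    by_contra! h
    have h1 := finrank_span_finset_le_card (R := K) ({a, b} : Finset (Module.Dual K U))
    rw [Set.finrank, Finset.coe_pair, (eq_top_iff.2 fun w _ => h w :
      Submodule.span K {a, b} = ⊤), finrank_top, Subspace.dual_finrank_eq] at h1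
    exact absurd (hd.trans (h1.trans Finset.card_le_two)) (by norm_num)
  let e := Equiv.ofBijective F hF
  have he (l) : F (e.symm l) = l := e.apply_symm_apply l
  have he_add (l m) : e.symm (l + m) = e.symm l + e.symm m := hF.1 (by simp [he])
  have he_smul (c : K) (l) : e.symm (c • l) = σ.symm c • e.symm l := hF.1 (by simp [he])
  -- the transpose of the inverse of `F`
  let f : U →ₛₗ[(σ : K →+* K)] U :=
    { toFun := fun u => (Module.evalEquiv K U).symm
        { toFun := fun l => σ (e.symm l u)
          map_add' := fun l m => by simp [he_add]
          map_smul' := fun c l => by simp [he_smul] }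
      map_add' := fun u v => by
        rw [← map_add]
        congr 1
        ext l
        simp
      map_smul' := fun c u => by
        rw [← map_smul]
        congr 1
        ext l
        simp }
  have hf (l : Module.Dual K U) (u : U) : F l (f u) = σ (l u) := by
    have : F l (f u) = σ (e.symm (F l) u) := by
      simp [f]
    rw [this, show e.symm (F l) = l from e.symm_apply_apply l]
  have hinj : Function.Injective f := (injective_iff_map_eq_zero f).2 fun u hu =>
    (Module.forall_dual_apply_eq_zero_iff K u).1 fun l => by simpa [hu] using (hf l u).symm
  refine ⟨σ, f, Finite.injective_iff_bijective.1 hinj, fun H u => ?_⟩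
  obtain ⟨l, hl, hH⟩ := H.exists_dual
  obtain ⟨b, hb, hFl⟩ := hFt l hl
  have h1 := hf l u
  rw [hFl] at h1
  rw [hH, (ht l hl).2 H hH, ← map_eq_zero_iff σ σ.injective (x := l u), ← h1]
  simp [hb]

/-- If a permutation of the hyperplanes maps the hyperplanes on a point to those on a point, for
all image points off some hyperplane `A`, then it preserves pencils. Only pencils whose image lies
on a subspace of `A` need an argument: the exchange property reduces them to the fact that their
members have no common point off `A`. -/
theorem preservesPencils_of_points {χ : Equiv.Perm (Hyperplane U)} (A : Hyperplane U)
    (h : ∀ y ∈ U, y ∉ A.1 → ∃ u : V, ∀ H, y ∈ (χ H).1 ↔ u ∈ H.1) : PreservesPencils χ := by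
  intro H₁ H₂ H₃ hle
  by_cases h12 : H₁ = H₂
  · subst h12
    rw [inf_idem] at hle
    rw [inf_idem, eq_of_le hle]
  by_cases hA : (χ H₁).1 ⊓ (χ H₂).1 ≤ A.1
  · have main : ∀ P Q : Hyperplane U, P.1 ⊓ Q.1 ≤ H₃.1 → (χ P).1 ⊓ (χ Q).1 ≤ A.1 → χ P ≠ A →
        (χ P).1 ⊓ (χ Q).1 ≤ (χ H₃).1 := by
      intro P Q hle hA hPA
      by_cases h3 : P = H₃
      · exact h3 ▸ inf_le_left
      have hPH : P.1 ⊓ H₃.1 ≤ Q.1 := exchange hle h3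
      have hPA' : (χ P).1 ⊓ (χ H₃).1 ≤ A.1 := by
        rintro y ⟨hyP, hy3⟩
        by_contra hyA
        obtain ⟨u, hu⟩ := h y ((χ P).le hyP) hyA
        exact hyA (hA ⟨hyP, (hu _).2 (hPH ⟨(hu _).1 hyP, (hu _).1 hy3⟩)⟩)
      exact (le_inf inf_le_left hA).trans (exchange hPA' hPA)
    by_cases h1 : χ H₁ = A
    · rw [inf_comm] at hle hA ⊢
      exact main _ _ hle hA fun h2 => h12 (χ.injective (h1.trans h2.symm))
    · exact main _ _ hle hA h1
  · refine (Submodule.le_or_le_of_forall fun y hy hyA => ?_).resolve_left hA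
    obtain ⟨u, hu⟩ := h y ((χ H₁).le hy.1) hyA
    exact (hu _).2 (hle ⟨(hu _).1 hy.1, (hu _).1 hy.2⟩)

end Hyperplane

/-! ### Vectors and points of a polar space -/

namespace PolarForm

variable {K V : Type*} [Field K] [AddCommGroup V] [Module K V]

/-- The field automorphism of the second argument of the form: the identity for alternating and
quadratic forms. -/
def companion : PolarForm K V → (K ≃+* K)
  | symplectic _ _ => RingEquiv.refl K
  | hermitian σ _ _ _ _ => σ
  | quadratic _ => RingEquiv.refl K

/-- The (polar) form as a semilinear map to the dual space, `w ↦ (v ↦ B v w)`. -/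
def pairing (F : PolarForm K V) : V →ₛₗ[(F.companion : K →+* K)] Module.Dual K V :=
  match F with
  | symplectic B _ => ⟨⟨fun w => B.flip w, fun v w => map_add _ v w⟩, fun c w => map_smul _ c w⟩
  | hermitian _ _ _ B _ => B.flip
  | quadratic Q => ⟨⟨fun w => Q.polarBilin.flip w, fun v w => map_add _ v w⟩,
      fun c w => map_smul _ c w⟩

theorem pairing_eq_zero_iff {F : PolarForm K V} {v w : V} : F.pairing w v = 0 ↔ F.Orth v w := by
  cases F <;> exact Iff.rfl

variable {F : PolarForm K V}

theorem orth_comm {v w : V} : F.Orth v w ↔ F.Orth w v := ⟨Orth.symm, Orth.symm⟩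

theorem Orth.add_right {v w w' : V} (h : F.Orth v w) (h' : F.Orth v w') : F.Orth v (w + w') :=
  (h.symm.add_left h'.symm).symm

theorem Orth.smul_right {v w : V} (c : K) (h : F.Orth v w) : F.Orth v (c • w) :=
  (h.symm.smul_left c).symm

theorem orth_add_right_iff {v w w' : V} (h : F.Orth v w) : F.Orth v (w + w') ↔ F.Orth v w' := by
  refine ⟨fun h' => ?_, h.add_right⟩
  have := h'.add_right (h.smul_right (-1))
  rwa [show w + w' + (-1 : K) • w = w' by module] at this

theorem orth_add_right_iff' {v w w' : V} (h : F.Orth v w') : F.Orth v (w + w') ↔ F.Orth v w := by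
  rw [add_comm, orth_add_right_iff h]

theorem orth_smul_right_iff {v w : V} {c : K} (hc : c ≠ 0) : F.Orth v (c • w) ↔ F.Orth v w := by
  refine ⟨fun h => ?_, fun h => h.smul_right c⟩
  simpa [smul_smul, inv_mul_cancel₀ hc] using h.smul_right c⁻¹

theorem IsSingularVec.add {v w : V} (hv : F.IsSingularVec v) (hw : F.IsSingularVec w)
    (h : F.Orth v w) : F.IsSingularVec (v + w) := by
  have h' := h.symm
  cases F with
  | symplectic B _ => simp_all [Orth, IsSingularVec]
  | hermitian _ _ _ B _ => simp_all [Orth, IsSingularVec]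
  | quadratic Q =>
    simp only [Orth, IsSingularVec, QuadraticMap.polar] at *
    rwa [hv, hw, sub_zero, sub_zero] at h

theorem IsSingularVec.smul {v : V} (c : K) (hv : F.IsSingularVec v) :
    F.IsSingularVec (c • v) := by
  cases F with
  | symplectic B _ => simp_all [IsSingularVec]
  | hermitian _ _ _ B _ => simp_all [IsSingularVec]
  | quadratic Q => simp_all [IsSingularVec, QuadraticMap.map_smul]

theorem IsSingularVec.orth_self {v : V} (hv : F.IsSingularVec v) : F.Orth v v := by
  cases F with
  | symplectic B _ => exact hv
  | hermitian _ _ _ B _ => exact hv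
  | quadratic Q =>
    have hv : Q v = 0 := hv
    simp [Orth, hv]

/-- A vector can be made singular by adding a multiple of a singular vector `u` that is not
orthogonal to it. In the hermitian case this is the surjectivity of the trace onto the fixed
field. -/
theorem exists_isSingularVec_add_smul {u v : V} (hu : F.IsSingularVec u) (h : ¬ F.Orth u v) :
    ∃ c : K, F.IsSingularVec (v + c • u) := by
  cases F with
  | symplectic B alt => exact ⟨0, alt _⟩
  | hermitian σ h2 hne B herm =>
    have hu : B u u = 0 := hu
    have h : B u v ≠ 0 := h
    -- an element of nonzero trace
    obtain ⟨a, ha⟩ : ∃ a, a + σ a ≠ 0 := by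
      by_contra! h0
      refine hne (RingEquiv.ext fun a => ?_)
      have h1 : σ a = -a := eq_neg_of_add_eq_zero_right (h0 a)
      have h3 : (1 : K) = -1 := by simpa using eq_neg_of_add_eq_zero_right (h0 1)
      rw [h1, ← neg_one_mul, ← h3, one_mul, RingEquiv.refl_apply]
    have hN : σ (B v v) = B v v := herm v v
    refine ⟨-(B v v) * (a + σ a)⁻¹ * a * (B u v)⁻¹, ?_⟩
    have h4 : σ (B u v) = B v u := herm u v
    have h5 : B v u ≠ 0 := by rwa [← h4, map_ne_zero]
    have ha' : σ a + a ≠ 0 := by rwa [add_comm]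
    change B (v + _ • u) (v + _ • u) = 0
    simp only [map_add, LinearMap.add_apply, map_smul, LinearMap.smul_apply, map_smulₛₗ, hu,
      smul_eq_mul, mul_zero, add_zero, map_mul, map_neg, map_inv₀, hN, h2, h4,
      RingHom.coe_coe]
    field_simp
    ring
  | quadratic Q =>
    have hu : Q u = 0 := hu
    have h : QuadraticMap.polar Q u v ≠ 0 := h
    refine ⟨-(Q v) * (QuadraticMap.polar Q u v)⁻¹, ?_⟩
    change Q (v + _) = 0
    rw [QuadraticMap.map_add Q, QuadraticMap.map_smul, hu, QuadraticMap.polar_smul_right,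
      QuadraticMap.polar_comm Q v u, smul_zero, smul_eq_mul, add_zero, mul_assoc,
      inv_mul_cancel₀ h]
    ring

theorem isTotallySingular_span_singleton {v : V} (hs : F.IsSingularVec v) :
    F.IsTotallySingular (K ∙ v) := by
  constructor
  · intro w hw
    obtain ⟨c, rfl⟩ := Submodule.mem_span_singleton.1 hw
    exact hs.smul c
  · intro w hw w' hw'
    obtain ⟨c, rfl⟩ := Submodule.mem_span_singleton.1 hw
    obtain ⟨c', rfl⟩ := Submodule.mem_span_singleton.1 hw'
    exact (hs.orth_self.smul_left c).smul_right c'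

namespace Point

instance [Finite V] : Finite F.Point :=
  Finite.of_injective (fun x => (x.space : Set V)) fun _ _ h =>
    Subtype.ext (Projectivization.submodule_injective (SetLike.ext' h))

/-- The point spanned by a nonzero singular vector. -/
def mk (v : V) (h0 : v ≠ 0) (hs : F.IsSingularVec v) : F.Point :=
  ⟨Projectivization.mk K v h0, isTotallySingular_span_singleton hs⟩

theorem exists_eq_mk (x : F.Point) : ∃ v h0 hs, x = mk v h0 hs := by
  obtain ⟨p, hp⟩ := x
  induction p with | h v hv =>
  exact ⟨v, hv, hp.1 v (Submodule.mem_span_singleton_self v), rfl⟩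

variable {v w : V} {h0 : v ≠ 0} {hs : F.IsSingularVec v} {h0' : w ≠ 0} {hs' : F.IsSingularVec w}

theorem mk_space : (mk v h0 hs).space = K ∙ v := rfl

@[simp]
theorem mk_space_le_iff {W : Submodule K V} : (mk v h0 hs).space ≤ W ↔ v ∈ W := by
  rw [mk_space, Submodule.span_singleton_le_iff_mem]

theorem mk_eq_mk_of_smul {c : K} (h : c • v = w) : mk w h0' hs' = mk v h0 hs :=
  Subtype.ext ((Projectivization.mk_eq_mk_iff' K _ _ _ _).2 ⟨c, h⟩)

theorem orth_mk_iff {u : V} : (∀ z ∈ (mk v h0 hs).space, F.Orth u z) ↔ F.Orth u v := by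
  refine ⟨fun h => h v (Submodule.mem_span_singleton_self v), fun h z hz => ?_⟩
  obtain ⟨c, rfl⟩ := Submodule.mem_span_singleton.1 hz
  exact h.smul_right c

@[simp]
theorem collinear_mk_iff : (mk v h0 hs).Collinear (mk w h0' hs') ↔ F.Orth v w := by
  simp only [Collinear, orth_mk_iff]
  refine ⟨fun h => h v (Submodule.mem_span_singleton_self v), fun h z hz => ?_⟩
  obtain ⟨c, rfl⟩ := Submodule.mem_span_singleton.1 hz
  exact h.smul_left c

theorem collinear_self (x : F.Point) : x.Collinear x := x.2.2

@[simp]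
theorem mem_perpIn_mk {U : Submodule K V} {u : V} :
    u ∈ (mk v h0 hs).perpIn U ↔ u ∈ U ∧ F.Orth u v :=
  and_congr_right fun _ => orth_mk_iff

end Point

variable {U : Submodule K V}

theorem mem_of_forall_orth (hU : Maximal F.IsTotallySingular U) {w : V}
    (hs : F.IsSingularVec w) (h : ∀ u ∈ U, F.Orth u w) : w ∈ U := by
  by_contra hw
  have h0 : w ≠ 0 := fun h0 => hw (h0 ▸ U.zero_mem)
  have := Point.perpIn_covBy (y := Point.mk w h0 hs) hU (by simpa using hw)
  exact this.lt.not_ge fun u hu => Point.mem_perpIn_mk.2 ⟨hu, h u hu⟩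

theorem exists_pairing_eq [FiniteDimensional K V] (hF : F.Nondegenerate)
    (hU : F.IsTotallySingular U) (l : Module.Dual K U) :
    ∃ v, ∀ u : U, F.pairing v u = l u := by
  let Φ : V →ₛₗ[(F.companion : K →+* K)] Module.Dual K U := U.subtype.dualMap.comp F.pairing
  suffices h : LinearMap.range Φ = ⊤ by
    obtain ⟨v, hv⟩ := LinearMap.range_eq_top.1 h l
    exact ⟨v, fun u => LinearMap.congr_fun hv u⟩
  by_contra h
  obtain ⟨f, hf, hle⟩ := Submodule.exists_le_ker_of_lt_top _ (lt_top_iff_ne_top.2 h)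
  obtain ⟨u, rfl⟩ := (Module.evalEquiv K U).surjective f
  have hu : (u : V) ≠ 0 := fun h0 => hf (by
    rw [show u = 0 from Subtype.ext h0, map_zero])
  obtain ⟨y, hy⟩ := hF (Point.mk u hu (hU.1 u u.2))
  obtain ⟨w, _, _, rfl⟩ := y.exists_eq_mk
  refine hy (Point.collinear_mk_iff.2 (pairing_eq_zero_iff.1 ?_))
  exact hle ⟨w, rfl⟩

/-- Every hyperplane of `U` is of the form `y^⊥ ∩ U`. -/
theorem exists_perp_eq [FiniteDimensional K V] (hF : F.Nondegenerate)
    (hU : F.IsTotallySingular U) (H : Hyperplane U) :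
    ∃ v, v ∉ U ∧ F.IsSingularVec v ∧ ∀ u ∈ U, F.Orth u v ↔ u ∈ H.1 := by
  obtain ⟨l, -, hl⟩ := H.exists_dual
  obtain ⟨v, hv⟩ := exists_pairing_eq hF hU l
  have hvH : ∀ u ∈ U, F.Orth u v ↔ u ∈ H.1 := fun u hu => by
    rw [← pairing_eq_zero_iff, hv ⟨u, hu⟩, ← hl]
  obtain ⟨e, heU, heH⟩ := H.exists_notMem
  obtain ⟨c, hc⟩ := exists_isSingularVec_add_smul (hU.1 e heU) (mt (hvH e heU).1 heH)
  have hvc : ∀ u ∈ U, F.Orth u (v + c • e) ↔ u ∈ H.1 := fun u hu => by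
    rw [orth_add_right_iff' ((hU.2 u hu e heU).smul_right c), hvH u hu]
  exact ⟨v + c • e, fun h => heH ((hvc e heU).1 (hU.2 e heU _ h)), hc, hvc⟩

/-- Every hyperplane of `U` other than `b^⊥ ∩ U` is of the form `y^⊥ ∩ U` with `y` collinear
to `b`. -/
theorem exists_orth_perp_eq [FiniteDimensional K V] (hF : F.Nondegenerate)
    (hU : F.IsTotallySingular U) {b : V} {Hb : Hyperplane U}
    (hb : ∀ u ∈ U, F.Orth u b ↔ u ∈ Hb.1) {H : Hyperplane U} (hne : H ≠ Hb) :
    ∃ v, v ∉ U ∧ F.IsSingularVec v ∧ F.Orth v b ∧ ∀ u ∈ U, F.Orth u v ↔ u ∈ H.1 := by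
  obtain ⟨v, -, -, hvH⟩ := exists_perp_eq hF hU H
  obtain ⟨e, heU, he⟩ := Hb.exists_notMem
  have heb : F.pairing b e ≠ 0 := fun h => he ((hb e heU).1 (pairing_eq_zero_iff.1 h))
  obtain ⟨e', heb', he'⟩ : ∃ e' ∈ Hb.1, e' ∉ H.1 :=
    SetLike.not_le_iff_exists.1 fun h => hne (Hyperplane.eq_of_le h).symm
  have heU' := Hb.le heb'
  -- adding vectors of `U` to `v` does not change `v^⊥ ∩ U`: make `v` orthogonal to `b`, and then
  -- singular
  obtain ⟨v', hv'b, hv'H⟩ : ∃ v', F.Orth v' b ∧ ∀ u ∈ U, F.Orth u v' ↔ u ∈ H.1 := by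
    refine ⟨v + (-(F.pairing b v * (F.pairing b e)⁻¹)) • e, ?_, fun u hu => ?_⟩
    · rw [← pairing_eq_zero_iff, map_add, map_smul, smul_eq_mul, neg_mul, mul_assoc,
        inv_mul_cancel₀ heb, mul_one, add_neg_cancel]
    · rw [orth_add_right_iff' ((hU.2 u hu e heU).smul_right _), hvH u hu]
  obtain ⟨c, hc⟩ := exists_isSingularVec_add_smul (hU.1 e' heU') (mt (hv'H e' heU').1 he')
  have hvc : ∀ u ∈ U, F.Orth u (v' + c • e') ↔ u ∈ H.1 := fun u hu => by
    rw [orth_add_right_iff' ((hU.2 u hu e' heU').smul_right c), hv'H u hu]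
  exact ⟨v' + c • e', fun h => he' ((hvc e' heU').1 (hU.2 e' heU' _ h)), hc,
    hv'b.add_left (((hb e' heU').2 heb').smul_left c), hvc⟩

/-- Two orthogonal singular vectors outside `U` with the same perp in `U` span a line meeting
`U`. -/
theorem exists_smul_eq_add (hU : Maximal F.IsTotallySingular U) {b c : V}
    (hb : F.IsSingularVec b) (hc : F.IsSingularVec c) (hbU : b ∉ U) (hcU : c ∉ U)
    (hbc : F.Orth b c) (h : ∀ u ∈ U, F.Orth u b ↔ F.Orth u c) :
    ∃ k : K, k ≠ 0 ∧ ∃ u ∈ U, k • c = b + u := by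
  obtain ⟨e, heU, he⟩ : ∃ e ∈ U, ¬ F.Orth e c := by
    by_contra! h'
    exact hcU (mem_of_forall_orth hU hc h')
  have he' : F.pairing c e ≠ 0 := mt pairing_eq_zero_iff.1 he
  let k := F.companion.symm (F.pairing b e * (F.pairing c e)⁻¹)
  have hk : F.companion k = F.pairing b e * (F.pairing c e)⁻¹ := F.companion.apply_symm_apply _
  have hmem : k • c + (-1 : K) • b ∈ U := by
    refine mem_of_forall_orth hU ((hc.smul k).add (hb.smul _)
      ((hbc.symm.smul_left k).smul_right _)) fun u hu => ?_
    have h1 : F.Orth (u + (-(F.pairing c u * (F.pairing c e)⁻¹)) • e) c := by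
      rw [← pairing_eq_zero_iff, map_add, map_smul, smul_eq_mul, neg_mul, mul_assoc,
        inv_mul_cancel₀ he', mul_one, add_neg_cancel]
    have h2 := (h _ (U.add_mem hu (U.smul_mem _ heU))).2 h1
    rw [← pairing_eq_zero_iff, map_add, map_smul, smul_eq_mul] at h2
    rw [← pairing_eq_zero_iff, map_add, map_smulₛₗ, map_smulₛₗ, LinearMap.add_apply,
      LinearMap.smul_apply, LinearMap.smul_apply, smul_eq_mul, smul_eq_mul, RingHom.coe_coe,
      hk, map_neg, map_one]
    linear_combination -h2
  refine ⟨k, ?_, _, hmem, by module⟩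
  intro h0
  refine hbU ?_
  simpa [h0] using hmem

/-- The hyperplane `w^⊥ ∩ U`, for a singular vector `w` outside `U`. -/
def perpHyp (hU : Maximal F.IsTotallySingular U) (w : V) (hw : w ∉ U) (hs : F.IsSingularVec w) :
    Hyperplane U :=
  ⟨(Point.mk w (U.ne_zero_of_notMem hw) hs).perpIn U,
    Point.perpIn_covBy hU (by simpa using hw)⟩

variable (hU : Maximal F.IsTotallySingular U)

@[simp]
theorem mem_perpHyp {w : V} {hw : w ∉ U} {hs : F.IsSingularVec w} {u : V} :
    u ∈ (perpHyp hU w hw hs).1 ↔ u ∈ U ∧ F.Orth u w :=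
  Point.mem_perpIn_mk

theorem perpHyp_eq {w : V} {hw : w ∉ U} {hs : F.IsSingularVec w} {H : Hyperplane U}
    (h : ∀ u ∈ U, F.Orth u w ↔ u ∈ H.1) : perpHyp hU w hw hs = H :=
  Hyperplane.eq_of_forall_mem fun u hu => (h u u.2).1 ((mem_perpHyp hU).1 hu).2

/-! ### The graph `Γ_φ` -/

/-- Points are near each other in `Γ_φ` if they are equal or adjacent. -/
def Near (F : PolarForm K V) (U : Submodule K V) (φ : Equiv.Perm (Hyperplane U))
    (x y : F.Point) : Prop :=
  x = y ∨ (F.switchedGraph U φ).Adj x y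

section Near

variable {φ : Equiv.Perm (Hyperplane U)}

theorem near_of_le {x y : F.Point} (hx : x.space ≤ U) (hy : y.space ≤ U) : F.Near U φ x y :=
  or_iff_not_imp_left.2 fun h => ⟨h, Or.inl ⟨hx, hy⟩⟩

theorem near_comm {x y : F.Point} : F.Near U φ x y ↔ F.Near U φ y x := by
  rw [Near, Near, SimpleGraph.adj_comm, eq_comm]

theorem near_iff_collinear {x y : F.Point} (hx : ¬ x.space ≤ U) (hy : ¬ y.space ≤ U) :
    F.Near U φ x y ↔ x.Collinear y := by
  constructor
  · rintro (rfl | ⟨-, h | h | h | h⟩)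
    · exact x.collinear_self
    · exact (hx h.1).elim
    · exact h.2.2
    · exact (hx h.1).elim
    · exact (hy h.2.1).elim
  · exact fun h => or_iff_not_imp_left.2 fun hne => ⟨hne, Or.inr (Or.inl ⟨hx, hy, h⟩)⟩

theorem near_iff_orth {v w : V} {h0 hs h0' hs'} (hv : v ∉ U) (hw : w ∉ U) :
    F.Near U φ (.mk v h0 hs) (.mk w h0' hs') ↔ F.Orth v w := by
  rw [near_iff_collinear (by simpa using hv) (by simpa using hw), Point.collinear_mk_iff]

theorem near_iff_mem {u w : V} {h0 hs h0' hs'} (hu : u ∈ U) (hw : w ∉ U) :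
    F.Near U φ (.mk u h0 hs) (.mk w h0' hs') ↔ u ∈ (φ (perpHyp hU w hw hs')).1 := by
  have hu' : (Point.mk u h0 hs).space ≤ U := by simpa using hu
  have hw' : ¬ (Point.mk w h0' hs').space ≤ U := by simpa using hw
  constructor
  · rintro (h | ⟨-, h | h | h | h⟩)
    · exact (hw' (h ▸ hu')).elim
    · exact (hw' h.2).elim
    · exact (h.1 hu').elim
    · obtain ⟨H, hH, h⟩ := h.2.2
      rw [show perpHyp hU w hw hs' = H from Subtype.ext hH.symm]
      simpa using h
    · exact (h.1 hu').elim
  · intro h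
    exact Or.inr ⟨fun h => hw' (h ▸ hu'),
      Or.inr (Or.inr (Or.inl ⟨hu', hw', perpHyp hU w hw hs', rfl, by simpa using h⟩))⟩

end Near

/-! ### Lines outside `U` -/

section Line

variable {v₁ v₂ : V} (h₁ : v₁ ∉ U) (hs₁ : F.IsSingularVec v₁) (h₂ : v₂ ∉ U)
  (hs₂ : F.IsSingularVec v₂) (h₁₂ : F.Orth v₁ v₂)
  (hne : perpHyp hU v₁ h₁ hs₁ ≠ perpHyp hU v₂ h₂ hs₂)

include hs₁ hs₂ h₁₂ in
theorem line_isSingularVec (t : K) : F.IsSingularVec (v₂ + t • v₁) :=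
  hs₂.add (hs₁.smul t) (h₁₂.symm.smul_right t)

include hne in
theorem line_notMem (t : K) : v₂ + t • v₁ ∉ U := by
  intro h
  refine hne (Hyperplane.eq_of_forall_mem fun u hu => ?_)
  rw [mem_perpHyp] at hu ⊢
  exact ⟨hu.1, (orth_add_right_iff' (hu.2.smul_right t)).1 (hU.1.2 u hu.1 _ h)⟩

include h₁₂ hne in
/-- Points of a line through two points with different perps in `U` have different perps in `U`. -/
theorem perp_line_ne {s t : K} (hst : s ≠ t) :
    ¬ ∀ u ∈ U, F.Orth u (v₂ + s • v₁) ↔ F.Orth u (v₂ + t • v₁) := by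
  intro h
  -- a vector of `U` orthogonal to both points would be orthogonal to the whole line
  have key : ∀ u ∈ (perpHyp hU _ (line_notMem hU h₁ hs₁ h₂ hs₂ hne s)
      (line_isSingularVec hs₁ hs₂ h₁₂ s)).1, F.Orth u v₁ ∧ F.Orth u v₂ := by
    intro u hu
    rw [mem_perpHyp] at hu
    have h1 := hu.2.add_right (((h u hu.1).1 hu.2).smul_right (-1))
    rw [show v₂ + s • v₁ + (-1 : K) • (v₂ + t • v₁) = (s - t) • v₁ by module,
      orth_smul_right_iff (sub_ne_zero.2 hst)] at h1
    exact ⟨h1, (orth_add_right_iff' (h1.smul_right s)).1 hu.2⟩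
  refine hne ((Hyperplane.eq_of_forall_mem fun u hu => ?_).symm.trans
    (Hyperplane.eq_of_forall_mem fun u hu => ?_)
    (b := perpHyp hU _ (line_notMem hU h₁ hs₁ h₂ hs₂ hne s) (line_isSingularVec hs₁ hs₂ h₁₂ s)))
  · exact (mem_perpHyp hU).2 ⟨u.2, (key u hu).1⟩
  · exact (mem_perpHyp hU).2 ⟨u.2, (key u hu).2⟩

end Line

/-! ### The image of `U` under an isomorphism -/

section Isomorphism

variable {φ χ : Equiv.Perm (Hyperplane U)} {g : F.Point ≃ F.Point}
  (hg : ∀ x y, F.Near U χ (g x) (g y) ↔ F.Near U φ x y)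

include hg

theorem near_symm_iff (x y : F.Point) :
    F.Near U φ (g.symm x) (g.symm y) ↔ F.Near U χ x y := by
  rw [← hg, g.apply_symm_apply, g.apply_symm_apply]

theorem orth_of_preimage {v w : V} {h0 hs h0' hs'} (hv : v ∉ U) (hw : w ∉ U)
    (hv' : (g.symm (.mk v h0 hs)).space ≤ U) (hw' : (g.symm (.mk w h0' hs')).space ≤ U) :
    F.Orth v w := by
  rw [← near_iff_orth (φ := χ) (h0 := h0) (hs := hs) (h0' := h0') (hs' := hs') hv hw,
    ← near_symm_iff hg]
  exact near_of_le hv' hw'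

/-- If `x₁`, `x₂` are outside `U` and some `u` in `U` is orthogonal to `x₁` but not to `x₂`, then
`x₁`, `x₁ + u` and `x₂` do not all lie in the clique `g(U)`. -/
theorem false_of_preimage {x₁ x₂ u : V} {h0 hs h0' hs' h0'' hs''} (hx₁ : x₁ ∉ U) (hx₂ : x₂ ∉ U)
    (hu : u ∈ U) (hu₂ : ¬ F.Orth u x₂) (h₁ : (g.symm (.mk x₁ h0 hs)).space ≤ U)
    (h₁' : (g.symm (.mk (x₁ + u) h0' hs')).space ≤ U)
    (h₂ : (g.symm (.mk x₂ h0'' hs'')).space ≤ U) : False := by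
  have hx₁' : x₁ + u ∉ U := fun h => hx₁ ((U.add_mem_iff_left hu).1 h)
  have e₁ := orth_of_preimage hg hx₂ hx₁ h₂ h₁
  have e₂ := orth_of_preimage hg hx₂ hx₁' h₂ h₁'
  exact hu₂ ((orth_add_right_iff e₁).1 e₂).symm

end Isomorphism

/-! ### Isomorphisms that move `U` -/

section LineImage

variable {φ χ : Equiv.Perm (Hyperplane U)} {g : F.Point ≃ F.Point}
  (hg : ∀ x y, F.Near U χ (g x) (g y) ↔ F.Near U φ x y)
  {v₁ v₂ : V} (h₁ : v₁ ∉ U) (hs₁ : F.IsSingularVec v₁) (h₂ : v₂ ∉ U)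
  (hs₂ : F.IsSingularVec v₂) (h₁₂ : F.Orth v₁ v₂)
  (hne : perpHyp hU v₁ h₁ hs₁ ≠ perpHyp hU v₂ h₂ hs₂)

/-- The image under `g` of the point `⟨v₂ + t v₁⟩` of the line `⟨v₁, v₂⟩`. -/
def lineImage (g : F.Point ≃ F.Point) (t : K) : F.Point :=
  g (.mk (v₂ + t • v₁) (U.ne_zero_of_notMem (line_notMem hU h₁ hs₁ h₂ hs₂ hne t))
    (line_isSingularVec hs₁ hs₂ h₁₂ t))

local notation "ℓ" => lineImage hU h₁ hs₁ h₂ hs₂ h₁₂ hne g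

/-- A point outside `g(U)` is near one or all points of the image of a line outside `U`. -/
theorem near_lineImage (hg : ∀ x y, F.Near U χ (g x) (g y) ↔ F.Near U φ x y) {y x : F.Point}
    (hy : g.symm y = .mk v₁ (U.ne_zero_of_notMem h₁) hs₁) (hx : ¬ (g.symm x).space ≤ U) :
    (∀ s t, s ≠ t → F.Near U χ x (ℓ s) → F.Near U χ x (ℓ t) → F.Near U χ x y) ∧
    (∀ s t, F.Near U χ x y → F.Near U χ x (ℓ s) → F.Near U χ x (ℓ t)) ∧
    (F.Near U χ x y ∨ ∃ t, F.Near U χ x (ℓ t)) := by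
  obtain ⟨n, n0, hn, e⟩ := (g.symm x).exists_eq_mk
  have hnU : n ∉ U := by simpa [e] using hx
  have hxy : F.Near U χ x y ↔ F.pairing n v₁ = 0 := by
    rw [← near_symm_iff hg, e, hy, near_iff_orth hnU h₁, pairing_eq_zero_iff, orth_comm]
  have hxℓ (t : K) : F.Near U χ x (ℓ t) ↔ F.pairing n v₂ + t * F.pairing n v₁ = 0 := by
    rw [← near_symm_iff hg, lineImage, g.symm_apply_apply, e,
      near_iff_orth hnU (line_notMem hU h₁ hs₁ h₂ hs₂ hne t), orth_comm, ← pairing_eq_zero_iff,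
      map_add, map_smul, smul_eq_mul]
  simp only [hxy, hxℓ]
  refine ⟨fun s t hst hs ht => ?_, fun s t h0 hs => by simpa [h0] using hs, ?_⟩
  · have : (s - t) * F.pairing n v₁ = 0 := by linear_combination hs - ht
    exact (mul_eq_zero.1 this).resolve_left (sub_ne_zero.2 hst)
  · refine or_iff_not_imp_left.2 fun h0 => ⟨-F.pairing n v₂ * (F.pairing n v₁)⁻¹, ?_⟩
    rw [mul_assoc, inv_mul_cancel₀ h0]
    ring

/-- Let `g` map `⟨v₁⟩` to a point `⟨y⟩` of `U` and `⟨v₂⟩` to a point `⟨b⟩` outside `U`. Then it maps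
the points `⟨v₂ + t v₁⟩` to points `⟨b + u⟩` with `u` in `U`: all of them are outside `U` and have
the same perp in `U`. -/
theorem exists_lineImage_eq (hg : ∀ x y, F.Near U χ (g x) (g y) ↔ F.Near U φ x y)
    {A : Hyperplane U} (hA : ∀ x ∈ U, ∀ h0 hs, (g.symm (.mk x h0 hs)).space ≤ U → x ∈ A.1)
    {y b : V} {y0 : y ≠ 0} {hys : F.IsSingularVec y} (hyU : y ∈ U) (hyA : y ∉ A.1)
    (hbU : b ∉ U) (hbs : F.IsSingularVec b)
    (ey : g.symm (.mk y y0 hys) = .mk v₁ (U.ne_zero_of_notMem h₁) hs₁)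
    (eb : g.symm (.mk b (U.ne_zero_of_notMem hbU) hbs) = .mk v₂ (U.ne_zero_of_notMem h₂) hs₂)
    (hyb : y ∈ (χ (perpHyp hU b hbU hbs)).1) (t : K) :
    ∃ u ∈ U, (t = 0 → u = 0) ∧ F.Orth u b ∧ ∃ h0 hs, ℓ t = .mk (b + u) h0 hs := by
  have ℓ0 : ℓ 0 = .mk b (U.ne_zero_of_notMem hbU) hbs := by
    rw [lineImage, ← Equiv.eq_symm_apply, eb]
    simp
  by_cases ht : t = 0
  · subst ht
    exact ⟨0, U.zero_mem, fun _ => rfl, F.orth_zero_left b, by simpa using U.ne_zero_of_notMem hbU,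
      by simpa using hbs, by simpa using ℓ0⟩
  obtain ⟨w, w0, hws, ew⟩ := (ℓ t).exists_eq_mk
  have hline {x : F.Point} (hx) := near_lineImage hU h₁ hs₁ h₂ hs₂ h₁₂ hne hg ey (x := x) hx
  have hwU : w ∉ U := by
    intro hwU
    -- otherwise all points of `U` off `A` would be near `⟨b⟩`
    have h : ∀ x ∈ U, x ∉ A.1 → x ∈ (χ (perpHyp hU b hbU hbs)).1 := by
      intro x hxU hxA
      have x0 : x ≠ 0 := by rintro rfl; exact hxA A.1.zero_mem
      have hxs := hU.1.1 x hxU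
      rw [← near_iff_mem hU (h0 := x0) (hs := hxs) (h0' := U.ne_zero_of_notMem hbU) hxU hbU, ← ℓ0]
      refine (hline fun h => hxA (hA x hxU x0 hxs h)).2.1 t 0 ?_ (ew ▸ ?_)
      · exact near_of_le (by simpa using hxU) (by simpa using hyU)
      · exact near_of_le (by simpa using hxU) (by simpa using hwU)
    rcases Submodule.le_or_le_of_forall h with h | h
    · exact A.2.lt.not_ge h
    · exact (χ (perpHyp hU b hbU hbs)).2.lt.not_ge h
  have hperp : perpHyp hU b hbU hbs = perpHyp hU w hwU hws := by
    refine χ.injective (Hyperplane.eq_of_le ((Submodule.le_or_le_of_forall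
      fun x hxb hxA => ?_).resolve_left fun h => hyA (h hyb)))
    have hxU := (χ (perpHyp hU b hbU hbs)).le hxb
    have x0 : x ≠ 0 := by rintro rfl; exact hxA A.1.zero_mem
    have hxs := hU.1.1 x hxU
    rw [← near_iff_mem hU (h0 := x0) (hs := hxs) (h0' := w0) hxU hwU, ← ew]
    refine (hline fun h => hxA (hA x hxU x0 hxs h)).2.1 0 t
      (near_of_le (by simpa using hxU) (by simpa using hyU)) ?_
    rw [ℓ0]
    exact (near_iff_mem hU hxU hbU).2 hxb
  have hbw : F.Orth b w := by
    rw [← near_iff_orth (φ := χ) (h0 := U.ne_zero_of_notMem hbU) (hs := hbs) (h0' := w0)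
      (hs' := hws) hbU hwU, ← ew, ← near_symm_iff hg, eb, lineImage, g.symm_apply_apply,
      near_iff_orth h₂ (line_notMem hU h₁ hs₁ h₂ hs₂ hne t)]
    exact hs₂.orth_self.add_right (h₁₂.symm.smul_right t)
  obtain ⟨k, hk, u, hu, e⟩ := exists_smul_eq_add hU hbs hws hbU hwU hbw fun u hu => by
    have := SetLike.ext_iff.1 (congrArg Subtype.val hperp) u
    simpa [hu] using this
  have hkw : F.IsSingularVec (b + u) := e ▸ hws.smul k
  have hb0 : b + u ≠ 0 := e ▸ smul_ne_zero hk w0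
  refine ⟨u, hu, fun h => (ht h).elim, ?_, hb0, hkw, ?_⟩
  · rw [orth_comm, ← orth_add_right_iff hbs.orth_self, ← e]
    exact hbw.smul_right k
  · rw [ew]
    exact (Point.mk_eq_mk_of_smul e).symm

end LineImage

section Switching

variable {φ χ : Equiv.Perm (Hyperplane U)} {g : F.Point ≃ F.Point}
  (hg : ∀ x y, F.Near U χ (g x) (g y) ↔ F.Near U φ x y)

include hU hg

theorem mem_of_preimage {m x : V} (hmU : m ∉ U) (hms : F.IsSingularVec m)
    (hm : (g.symm (.mk m (U.ne_zero_of_notMem hmU) hms)).space ≤ U) (hx : x ∈ U) {h0 hs}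
    (hx' : (g.symm (.mk x h0 hs)).space ≤ U) : x ∈ (χ (perpHyp hU m hmU hms)).1 := by
  rw [← near_iff_mem hU (h0 := h0) (hs := hs) (h0' := U.ne_zero_of_notMem hmU) hx hmU,
    ← near_symm_iff hg]
  exact near_of_le hx' hm

/-- A point `y` of `U` not near the point `⟨m⟩` of `g(U) \ U` has a neighbour outside both `U` and
`g(U)` that is collinear with `⟨m⟩`. -/
theorem exists_near_notMem [Finite V] [FiniteDimensional K V] (hF : F.Nondegenerate)
    (hd : 3 ≤ Module.finrank K U) {m y : V} (hmU : m ∉ U) (hms : F.IsSingularVec m) (hyU : y ∈ U)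
    (hyA : y ∉ (χ (perpHyp hU m hmU hms)).1) :
    ∃ (b : V) (hbU : b ∉ U) (hbs : F.IsSingularVec b),
      ¬ (g.symm (.mk b (U.ne_zero_of_notMem hbU) hbs)).space ≤ U ∧ F.Orth b m ∧
        y ∈ (χ (perpHyp hU b hbU hbs)).1 := by
  by_contra! hcon
  have hy0 : (⟨y, hyU⟩ : U) ≠ 0 := fun h => hyA (by
    rw [show y = 0 from congrArg Subtype.val h]
    exact Submodule.zero_mem _)
  obtain ⟨H, hH⟩ := Hyperplane.exists_mem hd ⟨y, hyU⟩
  obtain ⟨H₁, rfl⟩ := χ.surjective H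
  obtain ⟨u, hu0, hu₁, hum⟩ := Hyperplane.exists_ne_zero_mem_inf hd H₁ (perpHyp hU m hmU hms)
  -- `y` and `u` lie on equally many hyperplanes, and `u` lies on `m^⊥ ∩ U` while `y` is not on its
  -- image, so `u` cannot lie on all hyperplanes whose image contains `y`
  obtain ⟨H₂, hyH₂, huH₂⟩ : ∃ H₂, y ∈ (χ H₂).1 ∧ (u : V) ∉ H₂.1 := by
    by_contra! h
    have := Hyperplane.mem_iff_of_forall_imp hy0 hu0 (χ := χ.symm)
      (fun H hH => h (χ.symm H) (by simpa using hH)) (χ (perpHyp hU m hmU hms))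
    rw [χ.symm_apply_apply] at this
    exact hyA (this.1 hum)
  have hm : ∀ u ∈ U, F.Orth u m ↔ u ∈ (perpHyp hU m hmU hms).1 := fun u hu => by
    rw [mem_perpHyp, and_iff_right hu]
  obtain ⟨x₁, hx₁U, hx₁s, hx₁m, hx₁⟩ := exists_orth_perp_eq hF hU.1 hm (H := H₁)
    (by rintro rfl; exact hyA hH)
  obtain ⟨x₂, hx₂U, hx₂s, hx₂m, hx₂⟩ := exists_orth_perp_eq hF hU.1 hm (H := H₂)
    (by rintro rfl; exact hyA hyH₂)
  have hux₁ : F.Orth x₁ u := ((hx₁ u u.2).2 hu₁).symm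
  have hxuU : x₁ + u ∉ U := fun h => hx₁U ((U.add_mem_iff_left u.2).1 h)
  have hxus := hx₁s.add (hU.1.1 u u.2) hux₁
  have hxu : ∀ w ∈ U, F.Orth w (x₁ + u) ↔ w ∈ H₁.1 := fun w hw => by
    rw [orth_add_right_iff' (hU.1.2 w hw u u.2), hx₁ w hw]
  have hM : ∀ x (hx : x ∉ U) (hs : F.IsSingularVec x), F.Orth x m → ∀ H : Hyperplane U,
      y ∈ (χ H).1 → (∀ w ∈ U, F.Orth w x ↔ w ∈ H.1) →
        (g.symm (.mk x (U.ne_zero_of_notMem hx) hs)).space ≤ U := by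
    intro x hx hs hxm H hyH hxH
    by_contra hxM
    refine hcon x hx hs hxM hxm ?_
    rwa [perpHyp_eq hU hxH]
  exact false_of_preimage hg hx₁U hx₂U u.2 (mt (hx₂ u u.2).1 huH₂)
    (hM x₁ hx₁U hx₁s hx₁m H₁ hH hx₁)
    (hM _ hxuU hxus (hx₁m.add_left ((hm u u.2).2 hum)) H₁ hH hxu)
    (hM x₂ hx₂U hx₂s hx₂m H₂ hyH₂ hx₂)

/-- The heart of the argument: if `g(U)` contains a point `⟨m⟩` outside `U`, then every point `y`
of `U` not near `⟨m⟩` has a companion `u` such that `χ` maps the hyperplanes on `u` to those on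
`y`. -/
theorem exists_forall_mem_iff [Finite V] [FiniteDimensional K V] (hF : F.Nondegenerate)
    (hd : 3 ≤ Module.finrank K U) {m y : V} (hmU : m ∉ U) (hms : F.IsSingularVec m)
    (hm : (g.symm (.mk m (U.ne_zero_of_notMem hmU) hms)).space ≤ U) (hyU : y ∈ U)
    (hyA : y ∉ (χ (perpHyp hU m hmU hms)).1) :
    ∃ u : V, ∀ H, y ∈ (χ H).1 ↔ u ∈ H.1 := by
  have hy0 : y ≠ 0 := fun h => hyA (h ▸ Submodule.zero_mem _)
  have hys := hU.1.1 y hyU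
  obtain ⟨b, hbU, hbs, hbM, hbm, hyb⟩ := exists_near_notMem hU hg hF hd hmU hms hyU hyA
  have hyM : ¬ (g.symm (.mk y hy0 hys)).space ≤ U := fun h =>
    hyA (mem_of_preimage hU hg hmU hms hm hyU h)
  -- `y` and `b` correspond to points outside `U`, with distinct perps in `U` because only `b` is
  -- collinear with `m`
  obtain ⟨v₁, v10, hs₁, e₁⟩ := (g.symm (.mk y hy0 hys)).exists_eq_mk
  obtain ⟨v₂, v20, hs₂, e₂⟩ := (g.symm (.mk b (U.ne_zero_of_notMem hbU) hbs)).exists_eq_mk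
  obtain ⟨n, n0, hns, en⟩ := (g.symm (.mk m (U.ne_zero_of_notMem hmU) hms)).exists_eq_mk
  have h₁ : v₁ ∉ U := by simpa [e₁] using hyM
  have h₂ : v₂ ∉ U := by simpa [e₂] using hbM
  have hnU : n ∈ U := by simpa [en] using hm
  have h₁₂ : F.Orth v₁ v₂ := by
    rw [← near_iff_orth (φ := φ) (h0 := v10) (hs := hs₁) (h0' := v20) (hs' := hs₂) h₁ h₂, ← e₁,
      ← e₂, near_symm_iff hg, near_iff_mem hU hyU hbU]
    exact hyb
  have hne : perpHyp hU v₁ h₁ hs₁ ≠ perpHyp hU v₂ h₂ hs₂ := by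
    intro h
    apply hyA
    rw [← near_iff_mem hU (h0 := hy0) (hs := hys) (h0' := U.ne_zero_of_notMem hmU) hyU hmU,
      near_comm, ← near_symm_iff hg, en, e₁, near_iff_mem hU hnU h₁, h,
      ← near_iff_mem hU (h0 := n0) (hs := hns) (h0' := v20) hnU h₂, ← en, ← e₂, near_symm_iff hg,
      near_iff_orth hmU hbU]
    exact hbm.symm
  set ℓ := lineImage hU h₁ hs₁ h₂ hs₂ h₁₂ hne g with hℓ
  have hline {x : F.Point} (hx) := near_lineImage hU h₁ hs₁ h₂ hs₂ h₁₂ hne hg e₁ (x := x) hx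
  choose u huU hu0 hub hb0 hbs' hℓu using
    exists_lineImage_eq hU h₁ hs₁ h₂ hs₂ h₁₂ hne hg
      (fun x hx _ _ => mem_of_preimage hU hg hmU hms hm hx) hyU hyA hbU hbs e₁ e₂ hyb
  have hbuU (t : K) : b + u t ∉ U := fun h => hbU ((U.add_mem_iff_left (huU t)).1 h)
  have hnear {x : V} {h0 hs} (hx : x ∉ U) (t : K) :
      F.Near U χ (.mk x h0 hs) (ℓ t) ↔ F.Orth x (b + u t) := by
    rw [hℓ, hℓu, near_iff_orth hx (hbuU t)]
  have hne01 := perp_line_ne hU h₁ hs₁ h₂ hs₂ h₁₂ hne (one_ne_zero (α := K))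
  have hu1 : u 1 ≠ 0 := by
    intro h
    have h01 : ℓ 1 = ℓ 0 := by
      simp only [hℓ, hℓu, h, hu0 0 rfl]
    refine hne01 fun w _ => ?_
    rw [← Point.orth_mk_iff (h0 := U.ne_zero_of_notMem (line_notMem hU h₁ hs₁ h₂ hs₂ hne 1))
      (hs := line_isSingularVec hs₁ hs₂ h₁₂ 1), g.injective h01, Point.orth_mk_iff]
  have hbH : ∀ w ∈ U, F.Orth w b ↔ w ∈ (perpHyp hU b hbU hbs).1 := fun w hw => by
    rw [mem_perpHyp, and_iff_right hw]
  -- the images of the points of the line lie on the line through `⟨b⟩` and `⟨u 1⟩`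
  have hspan (t : K) : (⟨u t, huU t⟩ : U) ∈ Submodule.span K {⟨u 1, huU 1⟩} := by
    by_contra h
    have ht0 : t ≠ 0 := by
      rintro rfl
      refine h ?_
      simp only [hu0 0 rfl]
      exact Submodule.zero_mem _
    have ht1 : t ≠ 1 := by
      rintro rfl
      exact h (Submodule.mem_span_singleton_self _)
    have h' : (⟨u 1, huU 1⟩ : U) ∉ Submodule.span K {⟨u t, huU t⟩} := fun h' =>
      h (Submodule.mem_span_singleton_comm_of_ne_zero (fun h => hu1 (congrArg Subtype.val h)) h')
    obtain ⟨H₁, hH₁, hH₁'⟩ := Hyperplane.exists_mem_notMem h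
    obtain ⟨H₂, hH₂, hH₂'⟩ := Hyperplane.exists_mem_notMem h'
    obtain ⟨x₁, hx₁U, hx₁s, hx₁b, hx₁⟩ := exists_orth_perp_eq hF hU.1 hbH (H := H₁)
      (by rintro rfl; exact hH₁' ((mem_perpHyp hU).2 ⟨huU t, hub t⟩))
    obtain ⟨x₂, hx₂U, hx₂s, hx₂b, hx₂⟩ := exists_orth_perp_eq hF hU.1 hbH (H := H₂)
      (by rintro rfl; exact hH₂' ((mem_perpHyp hU).2 ⟨huU 1, hub 1⟩))
    -- a point outside `g(U)` collinear with two points of the image is collinear with all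
    have hM : ∀ x (hx : x ∉ U) (hs : F.IsSingularVec x), F.Orth x b → ∀ s ≠ 0, F.Orth x (u s) →
        ∀ r, ¬ F.Orth x (u r) → (g.symm (.mk x (U.ne_zero_of_notMem hx) hs)).space ≤ U := by
      intro x hx hs hxb s hs0 hxs r hxr
      by_contra hxM
      obtain ⟨c₁, c₂, -⟩ := hline hxM
      have n0 : F.Near U χ (.mk x (U.ne_zero_of_notMem hx) hs) (ℓ 0) := by
        rw [hnear hx, hu0 0 rfl, add_zero]
        exact hxb
      have n1 : F.Near U χ (.mk x (U.ne_zero_of_notMem hx) hs) (ℓ s) :=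
        (hnear hx s).2 (hxb.add_right hxs)
      exact hxr ((orth_add_right_iff hxb).1 ((hnear hx r).1 (c₂ s r (c₁ 0 s hs0.symm n0 n1) n1)))
    have hx₁u : F.Orth x₁ (u 1) := ((hx₁ _ (huU 1)).2 hH₁).symm
    have hxuU : x₁ + u 1 ∉ U := fun h => hx₁U ((U.add_mem_iff_left (huU 1)).1 h)
    refine false_of_preimage hg hx₁U hx₂U (huU 1) (fun h => hH₂' ((hx₂ _ (huU 1)).1 h))
      (hM x₁ hx₁U hx₁s hx₁b 1 one_ne_zero hx₁u t fun h => hH₁' ((hx₁ _ (huU t)).1 h.symm))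
      (hM _ hxuU (hx₁s.add (hU.1.1 _ (huU 1)) hx₁u) (hx₁b.add_left (hub 1)) 1 one_ne_zero
        (hx₁u.add_left (hU.1.2 _ (huU 1) _ (huU 1))) t fun h => hH₁' ((hx₁ _ (huU t)).1 ?_))
      (hM x₂ hx₂U hx₂s hx₂b t ht0 ((hx₂ _ (huU t)).2 hH₂).symm 1
        fun h => hH₂' ((hx₂ _ (huU 1)).1 h.symm))
    exact (orth_add_right_iff' (hU.1.2 _ (huU t) _ (huU 1))).1 h.symm
  -- a point whose perp contains `u 1` sees all points of the image of the line alike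
  have hall {x : V} {h0 hs} (hx : x ∉ U) (hxu : F.Orth x (u 1)) (t : K) :
      F.Near U χ (.mk x h0 hs) (ℓ t) ↔ F.Orth x b := by
    obtain ⟨c, hc⟩ := Submodule.mem_span_singleton.1 (hspan t)
    have hc : c • u 1 = u t := congrArg Subtype.val hc
    rw [hnear hx, orth_add_right_iff' (hc ▸ hxu.smul_right c)]
  have hgood : ∀ x (hx : x ∉ U) (hs : F.IsSingularVec x), F.Orth x (u 1) →
      ¬ (g.symm (.mk x (U.ne_zero_of_notMem hx) hs)).space ≤ U →
        y ∈ (χ (perpHyp hU x hx hs)).1 := by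
    intro x hx hs hxu hxM
    obtain ⟨c₁, c₂, c₃⟩ := hline hxM
    rw [← near_iff_mem hU (h0 := hy0) (hs := hys) (h0' := U.ne_zero_of_notMem hx) hyU hx, near_comm]
    refine c₃.elim id fun ⟨t, ht⟩ => ?_
    have hxb := (hall hx hxu t).1 ht
    exact c₁ 0 1 zero_ne_one ((hall hx hxu 0).2 hxb) ((hall hx hxu 1).2 hxb)
  have hu1' : (⟨u 1, huU 1⟩ : U) ≠ 0 := fun h => hu1 (congrArg Subtype.val h)
  refine ⟨u 1, Hyperplane.mem_iff_of_forall_imp (u := ⟨u 1, huU 1⟩) (v := ⟨y, hyU⟩) hu1'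
    (fun h => hy0 (congrArg Subtype.val h)) fun H hH => ?_⟩
  by_contra hyH
  -- otherwise all points with perp `H` lie in the clique `g(U)`, whence all of `g(U) \ U` is
  -- orthogonal to `u 1`
  have hbad : ∀ x (hx : x ∉ U) (hs : F.IsSingularVec x), (∀ w ∈ U, F.Orth w x ↔ w ∈ H.1) →
      (g.symm (.mk x (U.ne_zero_of_notMem hx) hs)).space ≤ U := by
    intro x hx hs hxH
    by_contra hxM
    have := hgood x hx hs ((hxH _ (huU 1)).2 hH).symm hxM
    rw [perpHyp_eq hU hxH] at this
    exact hyH this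
  obtain ⟨x₁, hx₁U, hx₁s, hx₁⟩ := exists_perp_eq hF hU.1 H
  have hMH : ∀ x, x ∉ U → ∀ h0 hs, (g.symm (.mk x h0 hs)).space ≤ U → F.Orth x (u 1) := by
    intro x hx h0 hs hxM
    by_contra hxu
    have hux₁ : F.Orth x₁ (u 1) := ((hx₁ _ (huU 1)).2 hH).symm
    have hxuU : x₁ + u 1 ∉ U := fun h => hx₁U ((U.add_mem_iff_left (huU 1)).1 h)
    refine false_of_preimage hg hx₁U hx (huU 1) (fun h => hxu h.symm) (hbad x₁ hx₁U hx₁s hx₁)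
      (hbad _ hxuU (hx₁s.add (hU.1.1 _ (huU 1)) hux₁) fun w hw => ?_) hxM
    rw [orth_add_right_iff' (hU.1.2 w hw _ (huU 1)), hx₁ w hw]
  -- so a point of `g(U)` not near `y` is near `ℓ 0` only if it is near `ℓ 1`, and the preimages
  -- `v₂` and `v₂ + v₁` get the same perp in `U`
  have hl (t : K) := line_notMem hU h₁ hs₁ h₂ hs₂ hne t
  have hls (t : K) := line_isSingularVec hs₁ hs₂ h₁₂ t
  have hsub : (φ (perpHyp hU _ (hl 0) (hls 0))).1 ≤ (φ (perpHyp hU v₁ h₁ hs₁)).1 ∨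
      (φ (perpHyp hU _ (hl 0) (hls 0))).1 ≤ (φ (perpHyp hU _ (hl 1) (hls 1))).1 := by
    refine Submodule.le_or_le_of_forall fun w hw hw₁ => ?_
    have hwU := (φ _).le hw
    have w0 : w ≠ 0 := by rintro rfl; exact hw₁ (Submodule.zero_mem _)
    have hws := hU.1.1 w hwU
    rw [← near_iff_mem hU (h0 := w0) (hs := hws) (h0' := U.ne_zero_of_notMem (hl _)) hwU (hl _),
      ← hg] at hw ⊢
    rw [← near_iff_mem hU (h0 := w0) (hs := hws) (h0' := v10) hwU h₁, ← e₁, ← hg,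
      g.apply_symm_apply] at hw₁
    obtain ⟨x, x0, hxs, ex⟩ := (g (.mk w w0 hws)).exists_eq_mk
    have hxM : (g.symm (.mk x x0 hxs)).space ≤ U := by
      rw [← ex, g.symm_apply_apply]
      simpa using hwU
    have hxU : x ∉ U := fun h => hw₁ (near_of_le (by simpa [ex] using h) (by simpa using hyU))
    rw [ex] at hw ⊢
    have hxu := hMH x hxU x0 hxs hxM
    exact (hall hxU hxu 1).2 ((hall hxU hxu 0).1 hw)
  rcases hsub with h | h
  · have h2 := φ.injective (Hyperplane.eq_of_le h)
    refine hne (h2.symm.trans ?_)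
    congr 1
    simp
  · have h2 := φ.injective (Hyperplane.eq_of_le h)
    refine hne01 fun w hw => ?_
    have h3 := SetLike.ext_iff.1 (congrArg Subtype.val h2) w
    rw [mem_perpHyp, mem_perpHyp, and_iff_right hw, and_iff_right hw] at h3
    exact h3.symm

theorem preservesPencils_of_not_le [Finite V] [FiniteDimensional K V] (hF : F.Nondegenerate)
    (hd : 3 ≤ Module.finrank K U) {x : F.Point} (hx : x.space ≤ U) (hgx : ¬ (g x).space ≤ U) :
    Hyperplane.PreservesPencils χ := by
  obtain ⟨m, m0, hms, e⟩ := (g x).exists_eq_mk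
  have hmU : m ∉ U := by simpa [e] using hgx
  refine Hyperplane.preservesPencils_of_points (χ (perpHyp hU m hmU hms)) fun y hyU hyA =>
    exists_forall_mem_iff hU hg hF hd hmU hms ?_ hyU hyA
  rwa [← e, g.symm_apply_apply]

end Switching

/-! ### Isomorphisms that fix `U` -/

section Stabilizer

variable {φ χ : Equiv.Perm (Hyperplane U)} {g : F.Point ≃ F.Point}
  (hg : ∀ x y, F.Near U χ (g x) (g y) ↔ F.Near U φ x y)
  (hgU : ∀ x : F.Point, (g x).space ≤ U ↔ x.space ≤ U)

include hU hgU

theorem hyperplane_eq_of_forall_point {H₁ H₂ : Hyperplane U}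
    (h : ∀ x : F.Point, x.space ≤ U → (g x).space ≤ H₁.1 → (g x).space ≤ H₂.1) : H₁ = H₂ := by
  refine Hyperplane.eq_of_forall_mem fun u hu => ?_
  by_cases u0 : (u : V) = 0
  · simp [u0]
  have hus := hU.1.1 u u.2
  have := h (g.symm (.mk u u0 hus)) ((hgU _).1 (by simp)) (by simpa using hu)
  simpa using this

/-- The action on hyperplanes preserves pencils because it comes from an action on the points of
`U`. -/
theorem preservesPencils_of_le_iff {α : Equiv.Perm (Hyperplane U)}
    (hα : ∀ H, ∀ x : F.Point, x.space ≤ U → ((g x).space ≤ (α H).1 ↔ x.space ≤ H.1)) :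
    Hyperplane.PreservesPencils α := by
  rintro H₁ H₂ H₃ hle v ⟨hv₁, hv₂⟩
  by_cases v0 : v = 0
  · exact v0 ▸ Submodule.zero_mem _
  have hvU := (α H₁).le hv₁
  let x := g.symm (Point.mk v v0 (hU.1.1 v hvU))
  have hx : x.space ≤ U := (hgU x).1 (by simpa [x] using hvU)
  have hH (H : Hyperplane U) : v ∈ (α H).1 ↔ x.space ≤ H.1 := by
    rw [← hα H x hx]
    simp [x]
  rw [SetLike.mem_coe, hH] at hv₁ hv₂
  exact (hH H₃).2 ((le_inf hv₁ hv₂).trans hle)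

include hg

/-- The hyperplane `φ (w^⊥ ∩ U)` is mapped to the hyperplane `χ (w'^⊥ ∩ U)`, where `⟨w'⟩` is the
image of `⟨w⟩`. -/
theorem le_apply_perpHyp_iff {w w' : V} (hw : w ∉ U) {hs : F.IsSingularVec w} (hw' : w' ∉ U)
    {hs' : F.IsSingularVec w'}
    (e : g (.mk w (U.ne_zero_of_notMem hw) hs) = .mk w' (U.ne_zero_of_notMem hw') hs')
    {x : F.Point} (hx : x.space ≤ U) :
    (g x).space ≤ (χ (perpHyp hU w' hw' hs')).1 ↔ x.space ≤ (φ (perpHyp hU w hw hs)).1 := by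
  have hgx := (hgU x).2 hx
  obtain ⟨z, z0, hzs, ez⟩ := (g x).exists_eq_mk
  obtain ⟨u, u0, hus, rfl⟩ := x.exists_eq_mk
  rw [ez, Point.mk_space_le_iff] at hgx
  rw [Point.mk_space_le_iff] at hx
  rw [ez, Point.mk_space_le_iff, Point.mk_space_le_iff,
    ← near_iff_mem hU (h0 := z0) (hs := hzs) (h0' := U.ne_zero_of_notMem hw') hgx hw',
    ← near_iff_mem hU (h0 := u0) (hs := hus) (h0' := U.ne_zero_of_notMem hw) hx hw, ← ez, ← e, hg]

/-- The permutation of the hyperplanes of `U` induced by an isomorphism that fixes `U`. -/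
theorem exists_perm_le_iff [Finite V] [FiniteDimensional K V] (hF : F.Nondegenerate) :
    ∃ α : Equiv.Perm (Hyperplane U), ∀ H, ∀ x : F.Point, x.space ≤ U →
      ((g x).space ≤ (α H).1 ↔ x.space ≤ H.1) := by
  have h (H : Hyperplane U) : ∃ H' : Hyperplane U, ∀ x : F.Point, x.space ≤ U →
      ((g x).space ≤ H'.1 ↔ x.space ≤ H.1) := by
    obtain ⟨w, hwU, hws, hw⟩ := exists_perp_eq hF hU.1 (φ.symm H)
    obtain ⟨w', w0', hws', e⟩ := (g (.mk w (U.ne_zero_of_notMem hwU) hws)).exists_eq_mk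
    have hwU' : w' ∉ U := by
      have := (hgU (.mk w (U.ne_zero_of_notMem hwU) hws)).not
      rw [e, Point.mk_space_le_iff, Point.mk_space_le_iff] at this
      exact this.2 hwU
    refine ⟨χ (perpHyp hU w' hwU' hws'), fun x hx => ?_⟩
    rw [le_apply_perpHyp_iff hU hg hgU hwU hwU' e hx, perpHyp_eq hU (hw := hwU) hw,
      φ.apply_symm_apply]
  choose T hT using h
  have hinj : Function.Injective T := fun H₁ H₂ h =>
    Hyperplane.eq_of_forall_mem fun u hu => by
      by_cases u0 : (u : V) = 0
      · simp [u0]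
      have h1 := hT H₁ (.mk u u0 (hU.1.1 u u.2)) (by simp)
      have h2 := hT H₂ (.mk u u0 (hU.1.1 u u.2)) (by simp)
      rw [h] at h1
      simpa using h2.1 (h1.2 (by simpa using hu))
  exact ⟨Equiv.ofBijective T (Finite.injective_iff_bijective.1 hinj), hT⟩

/-- Preservation of pencils by the permutation `y^⊥ ∩ U ↦ (g y)^⊥ ∩ U`: hyperplanes of a pencil are
the perps in `U` of the points of a line outside `U`, and the image of such a line determines the
intersection of the corresponding perps. -/
theorem preservesPencils_of_perpHyp [Finite V] [FiniteDimensional K V] (hF : F.Nondegenerate)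
    {β : Equiv.Perm (Hyperplane U)}
    (hβ : ∀ (w w' : V) (hw : w ∉ U) (hs : F.IsSingularVec w) (hw' : w' ∉ U)
      (hs' : F.IsSingularVec w'),
      g (.mk w (U.ne_zero_of_notMem hw) hs) = .mk w' (U.ne_zero_of_notMem hw') hs' →
        β (perpHyp hU w hw hs) = perpHyp hU w' hw' hs') :
    Hyperplane.PreservesPencils β := by
  intro H₁ H₂ H₃ hle
  by_cases h12 : H₁ = H₂
  · subst h12
    rw [inf_idem] at hle
    rw [inf_idem, Hyperplane.eq_of_le hle]
  obtain ⟨v₁, hv₁, hs₁, hH₁⟩ := exists_perp_eq hF hU.1 H₁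
  obtain ⟨v₂, hv₂, hs₂, h21, hH₂⟩ := exists_orth_perp_eq hF hU.1 hH₁ (Ne.symm h12)
  -- the point of the line `⟨v₁, v₂⟩` with perp `H₃`
  obtain ⟨v₃, hv₃, hs₃, hH₃, h3⟩ : ∃ v₃, v₃ ∉ U ∧ F.IsSingularVec v₃ ∧
      (∀ u ∈ U, F.Orth u v₃ ↔ u ∈ H₃.1) ∧
        ∀ w, F.Orth w v₁ → F.Orth w v₂ → F.Orth w v₃ := by
    obtain ⟨l, hl0, hl⟩ := H₃.exists_dual
    have hdual {v : V} {H : Hyperplane U} (h : ∀ u ∈ U, F.Orth u v ↔ u ∈ H.1) (u : U) :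
        (u : V) ∈ H.1 ↔ U.subtype.dualMap (F.pairing v) u = 0 := by
      rw [← h u u.2, ← pairing_eq_zero_iff]
      rfl
    obtain ⟨a, b, hab⟩ := Submodule.mem_span_pair.1
      ((Hyperplane.inf_le_iff_mem_span (hdual hH₁) (hdual hH₂) hl).1 hle)
    have hv : ∀ u ∈ U, F.Orth u (F.companion.symm a • v₁ + F.companion.symm b • v₂) ↔
        u ∈ H₃.1 := by
      intro u hu
      rw [hl ⟨u, hu⟩, ← pairing_eq_zero_iff, ← hab]
      simp
    refine ⟨F.companion.symm a • v₁ + F.companion.symm b • v₂, fun h => ?_,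
      (hs₁.smul _).add (hs₂.smul _) ((h21.symm.smul_left _).smul_right _), hv,
      fun w h h' => (h.smul_right _).add_right (h'.smul_right _)⟩
    obtain ⟨e, he, he'⟩ := H₃.exists_notMem
    exact he' ((hv e he).1 (hU.1.2 e he _ h))
  have himage (v : V) (hv : v ∉ U) (hs : F.IsSingularVec v) : ∃ (w : V) (hw : w ∉ U)
      (hws : F.IsSingularVec w), g (.mk v (U.ne_zero_of_notMem hv) hs) =
        .mk w (U.ne_zero_of_notMem hw) hws := by
    obtain ⟨w, w0, hws, e⟩ := (g (.mk v (U.ne_zero_of_notMem hv) hs)).exists_eq_mk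
    have := (hgU (.mk v (U.ne_zero_of_notMem hv) hs)).not
    rw [e, Point.mk_space_le_iff, Point.mk_space_le_iff] at this
    exact ⟨w, this.2 hv, hws, e⟩
  obtain ⟨w₁, hw₁, hws₁, e₁⟩ := himage v₁ hv₁ hs₁
  obtain ⟨w₂, hw₂, hws₂, e₂⟩ := himage v₂ hv₂ hs₂
  obtain ⟨w₃, hw₃, hws₃, e₃⟩ := himage v₃ hv₃ hs₃
  -- what is outside `U` and orthogonal to `w₁` and `w₂` is orthogonal to `w₃`
  have hw3 : ∀ x, x ∉ U → F.IsSingularVec x → F.Orth x w₁ → F.Orth x w₂ → F.Orth x w₃ := by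
    intro x hx hxs
    have x0 := U.ne_zero_of_notMem hx
    obtain ⟨n, n0, hns, en⟩ := (g.symm (.mk x x0 hxs)).exists_eq_mk
    have hn : n ∉ U := by
      have := (hgU (g.symm (.mk x x0 hxs))).not
      rw [g.apply_symm_apply, en, Point.mk_space_le_iff, Point.mk_space_le_iff] at this
      exact this.1 hx
    have hiff {v w : V} (hv : v ∉ U) {hs : F.IsSingularVec v} (hw : w ∉ U)
        {hws : F.IsSingularVec w} (e : g (.mk v (U.ne_zero_of_notMem hv) hs) =
          .mk w (U.ne_zero_of_notMem hw) hws) : F.Orth x w ↔ F.Orth n v := by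
      rw [← near_iff_orth (φ := χ) (h0 := x0) (hs := hxs) (h0' := U.ne_zero_of_notMem hw)
        (hs' := hws) hx hw, ← e, ← near_symm_iff hg, en, g.symm_apply_apply, near_iff_orth hn hv]
    rw [hiff hv₁ hw₁ e₁, hiff hv₂ hw₂ e₂, hiff hv₃ hw₃ e₃]
    exact h3 n
  have hβ' {v w : V} (hv : v ∉ U) {hs : F.IsSingularVec v} (hw : w ∉ U) {hws : F.IsSingularVec w}
      {H : Hyperplane U} (hH : ∀ u ∈ U, F.Orth u v ↔ u ∈ H.1)
      (e : g (.mk v (U.ne_zero_of_notMem hv) hs) = .mk w (U.ne_zero_of_notMem hw) hws) :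
      β H = perpHyp hU w hw hws := by
    rw [← perpHyp_eq hU (hw := hv) (hs := hs) hH, hβ _ _ _ _ _ _ e]
  rw [hβ' hv₁ hw₁ hH₁ e₁, hβ' hv₂ hw₂ hH₂ e₂, hβ' hv₃ hw₃ hH₃ e₃]
  rintro u ⟨hu₁, hu₂⟩
  obtain ⟨huU, hu₁⟩ := (mem_perpHyp hU).1 hu₁
  obtain ⟨-, hu₂⟩ := (mem_perpHyp hU).1 hu₂
  -- apply this to `w₁` and `w₁ + u`
  have h12' : F.Orth w₁ w₂ := by
    rw [← near_iff_orth (φ := χ) (h0 := U.ne_zero_of_notMem hw₁) (hs := hws₁)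
      (h0' := U.ne_zero_of_notMem hw₂) (hs' := hws₂) hw₁ hw₂, ← e₁, ← e₂, hg,
      near_iff_orth hv₁ hv₂]
    exact h21.symm
  have h13 := hw3 w₁ hw₁ hws₁ hws₁.orth_self h12'
  have h13' := hw3 (w₁ + u) (fun h => hw₁ ((U.add_mem_iff_left huU).1 h))
    (hws₁.add (hU.1.1 u huU) hu₁.symm) (hws₁.orth_self.add_left hu₁) (h12'.add_left hu₂)
  exact (mem_perpHyp hU).2 ⟨huU, ((orth_add_right_iff h13.symm).1 h13'.symm).symm⟩

end Stabilizer

end PolarForm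

/-! ### Isomorphic graphs and double cosets -/

theorem mainTheorem5 {K V : Type*} [Field K] [Finite K] [AddCommGroup V] [Module K V]
    [FiniteDimensional K V] (F : PolarForm K V) (hF : F.Nondegenerate)
    (U : Submodule K V) (hU : Maximal F.IsTotallySingular U) (hd : 3 ≤ Module.finrank K U)
    (φ χ : Equiv.Perm (Hyperplane U))
    (hiso : Nonempty (F.switchedGraph U φ ≃g F.switchedGraph U χ)) :
    DoubleCoset.doubleCoset φ (PGammaL U : Set (Equiv.Perm (Hyperplane U))) (PGammaL U) =
      DoubleCoset.doubleCoset χ (PGammaL U : Set (Equiv.Perm (Hyperplane U))) (PGammaL U) := by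
  have : Finite V := Module.finite_of_finite K
  obtain ⟨e⟩ := hiso
  let g : F.Point ≃ F.Point := e.toEquiv
  have hg : ∀ x y, F.Near U χ (g x) (g y) ↔ F.Near U φ x y := fun x y =>
    or_congr g.apply_eq_iff_eq e.map_adj_iff
  suffices h : ∃ α ∈ PGammaL U, ∃ β ∈ PGammaL U, χ = α * φ * β by
    obtain ⟨α, hα, β, hβ, h⟩ := h
    exact (DoubleCoset.doubleCoset_eq_of_mem
      (DoubleCoset.mem_doubleCoset.2 ⟨α, hα, β, hβ, h⟩)).symm
  by_cases hgU : ∀ x : F.Point, x.space ≤ U → (g x).space ≤ U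
  · have hgU' := g.iff_of_forall_imp hgU
    obtain ⟨α, hα⟩ := PolarForm.exists_perm_le_iff hU hg hgU' hF
    have hβ : Hyperplane.PreservesPencils (χ⁻¹ * α * φ) := by
      refine PolarForm.preservesPencils_of_perpHyp hU hg hgU' hF fun w w' hw hs hw' hs' ew => ?_
      refine χ.injective (PolarForm.hyperplane_eq_of_forall_point hU hgU' fun x hx h => ?_)
      rw [PolarForm.le_apply_perpHyp_iff hU hg hgU' hw hw' ew hx, ← hα _ x hx]
      simpa using h
    refine ⟨α, (PolarForm.preservesPencils_of_le_iff hU hgU' hα).mem_PGammaL hd,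
      (χ⁻¹ * α * φ)⁻¹, inv_mem (hβ.mem_PGammaL hd), ?_⟩
    group
  · push Not at hgU
    obtain ⟨x, hx, hgx⟩ := hgU
    have hχ := (PolarForm.preservesPencils_of_not_le hU hg hF hd hx hgx).mem_PGammaL hd
    -- by finiteness the inverse does not fix `U` either
    obtain ⟨y, hy, hgy⟩ : ∃ y : F.Point, y.space ≤ U ∧ ¬ (g.symm y).space ≤ U := by
      by_contra! h
      refine hgx ((g.symm.iff_of_forall_imp h (g x)).1 ?_)
      rwa [g.symm_apply_apply]
    have hφ := (PolarForm.preservesPencils_of_not_le hU (PolarForm.near_symm_iff hg) hF hd hy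
      hgy).mem_PGammaL hd
    exact ⟨χ * φ⁻¹, mul_mem hχ (inv_mem hφ), 1, one_mem _, by group⟩
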